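/- Let $n\ge 1$, let $\Omega_1',\dots,\Omega_n'$ be finite sets, and let $\mu$ be a probability distribution on $\Omega_1'\times\cdots\times\Omega_n'$. Let $\Omega=\bigsqcup_{i=1}^n\Omega_i'=\bigcup_{i=1}^n \Omega_i'\times\{i\}$ and let $\binom{\Omega}{k}$ denote the family of $k$-element subsets of $\Omega$. The homogenization $\mu^{\mathrm{hom}}$ of $\mu$ is the distribution on $\binom{\Omega}{n}$ obtained by identifying $\sigma$ with $\{(\sigma_1,1),\dots,(\sigma_n,n)\}$. For $0\le \ell\le k\le n$ let $D_{k\to\ell}(A,B)=\mathbf 1_{B\subseteq A}\binom{k}{\ell}^{-1}$ be the down operator, a Markov kernel from $\binom{\Omega}{k}$ to $\binom{\Omega}{\ell}$, and let $\mu_k=\mu^{\mathrm{hom}}D_{n\to k}$. Let $$U_{\ell\to k}(B,A)=\mathbf 1_{B\subseteq A}\frac{\mu_k(A)}{\sum_{A'\supseteq B}\mu_k(A')}$$ be the up operator from $\binom{\Omega}{\ell}$ to $\binom{\Omega}{k}$ (defined for $B$ in the support of $\mu_\ell$), and let $P_{k\leftrightarrow\ell}=D_{k\to\ell}U_{\ell\to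 k}$ be the $k\leftrightarrow\ell$ down-up walk. For probability distributions $\nu\ll\pi$ on a finite set let $D_f(\nu\|\pi)=\mathbb E_{x\sim\pi} f(\nu(x)/\pi(x))$, with $f(x)=(x-1)^2$ for the $\chi^2$-divergence and $f(x)=x\ln x$ (where $0\ln 0=0$) for the KL-divergence. A kernel $P$ satisfies $\rho$-contraction in $D_f$ with respect to $\pi$ if $D_f(\nu P\|\pi P)\le\rho\, D_f(\nu\|\pi)$ for all probability distributions $\nu\ll\pi$. Below, contraction of $D_{k\to\ell}$ and of $P_{k\leftrightarrow\ell}$ is with respect to $\mu_k$ (so that of $D_{n\to n-1}$ is with respect to $\mu_n=\mu^{\mathrm{hom}}$). Let $C>0$. Then: 1. If $D_{n\to n-1}$ satisfies $\left(1-\frac{1}{Cn}\right)$-contraction in $\chi^2$-divergence, then for all $0\le\ell\le k\le n$, $D_{k\to\ell}$ satisfies $\prod_{j=\ell+1}^{k}\left(1-\frac{1}{j\left(C+\frac{n-j+1}{n}\right)}\right)$-contraction in $\chi^2$-divergence. 2. If $D_{n\to n-1}$ satisfies $\left(1-\frac{1}{Cn}\right)$-contraction in KL-divergence (that is, $\mu$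 satisfies $C$-approximate tensorization of entropy), then for all $0\le\ell\le k\le n$, both $D_{k\to\ell}$ and $P_{k\leftrightarrow\ell}$ satisfy $\prod_{j=\ell+1}^{k}\left(1-\frac{1}{j(C+1)}\right)$-contraction in KL-divergence. -/

import Mathlib

namespace DownUp

open scoped Matrix

/-- The family of all `k`-element subsets of a finite set `Ω`. -/
abbrev Slice (Ω : Type*) (k : ℕ) : Type _ := {S : Finset Ω // S.card = k}

/-- The `f`-divergence `D_f(ν ‖ μ) = E_{x ∼ μ} f (ν x / μ x)` of probability mass functions
on a finite set. It is only used for `ν ≪ μ`. -/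
noncomputable def fDiv {α : Type*} [Fintype α] (f : ℝ → ℝ) (ν μ : α → ℝ) : ℝ :=
  ∑ x, μ x * f (ν x / μ x)

/-- The function whose `f`-divergence is the `χ²`-divergence. -/
def chiSqFun (x : ℝ) : ℝ := (x - 1) ^ 2

/-- The function whose `f`-divergence is the KL-divergence. -/
noncomputable def klFun (x : ℝ) : ℝ := x * Real.log x

/-- The kernel `P` from `α` to `β` satisfies `ρ`-contraction in `f`-divergence with respect to
`μ`: for every probability mass function `ν ≪ μ`, `D_f(νP ‖ μP) ≤ ρ D_f(ν ‖ μ)`. -/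
def Contracts {α β : Type*} [Fintype α] [Fintype β] (f : ℝ → ℝ) (P : Matrix α β ℝ) (ρ : ℝ)
    (μ : α → ℝ) : Prop :=
  ∀ ν ∈ stdSimplex ℝ α, (∀ x, μ x = 0 → ν x = 0) →
    fDiv f (ν ᵥ* P) (μ ᵥ* P) ≤ ρ * fDiv f ν μ

/-- The down operator `D_{k → ℓ}`: pass to a uniformly random `ℓ`-element subset. -/
noncomputable def down (Ω : Type*) [DecidableEq Ω] (k ℓ : ℕ) :
    Matrix (Slice Ω k) (Slice Ω ℓ) ℝ :=
  fun A B => if B.1 ⊆ A.1 then 1 / (k.choose ℓ : ℝ) else 0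

/-- The up operator `U_{ℓ → k}` with respect to a distribution `μ` on the `k`-element subsets.
(Rows of sets `B` that no set in the support of `μ` contains are zero; such `B` have probability
zero under `μ D_{k → ℓ}`.) -/
noncomputable def up {Ω : Type*} [Fintype Ω] [DecidableEq Ω] {k : ℕ} (ℓ : ℕ)
    (μ : Slice Ω k → ℝ) : Matrix (Slice Ω ℓ) (Slice Ω k) ℝ :=
  fun B A => if B.1 ⊆ A.1 then μ A / ∑ A' : Slice Ω k with B.1 ⊆ A'.1, μ A' else 0

/-- The `k ↔ ℓ` down-up walk `D_{k → ℓ} U_{ℓ → k}` with respect to a distribution `μ` on the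
`k`-element subsets. -/
noncomputable def downUpWalk {Ω : Type*} [Fintype Ω] [DecidableEq Ω] {k : ℕ} (ℓ : ℕ)
    (μ : Slice Ω k → ℝ) : Matrix (Slice Ω k) (Slice Ω k) ℝ :=
  down Ω k ℓ * up ℓ μ

/-- The identification of `σ ∈ Ω'₁ × ⋯ × Ω'ₙ` with the `n`-element subset
`{(1, σ₁), …, (n, σₙ)}` of the disjoint union of the `Ω'ᵢ`. -/
def toSlice {n : ℕ} {Ω' : Fin n → Type*} (σ : ∀ i, Ω' i) : Slice (Σ i, Ω' i) n :=
  ⟨Finset.univ.map ⟨fun i => ⟨i, σ i⟩, fun _ _ h => congrArg Sigma.fst h⟩, by simp⟩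

/-- The homogenization of a distribution on a product space: its image under `toSlice`. -/
noncomputable def homogenization {n : ℕ} {Ω' : Fin n → Type*} [∀ i, Fintype (Ω' i)]
    [∀ i, DecidableEq (Ω' i)] (μ : (∀ i, Ω' i) → ℝ) : Slice (Σ i, Ω' i) n → ℝ :=
  fun S => ∑ σ : (∀ i, Ω' i) with toSlice σ = S, μ σ

/-- The distribution `μ_k = μ^hom D_{n → k}` on the `k`-element subsets. -/
noncomputable def homLevel {n : ℕ} {Ω' : Fin n → Type*} [∀ i, Fintype (Ω' i)]
    [∀ i, DecidableEq (Ω' i)] (μ : (∀ i, Ω' i) → ℝ) (k : ℕ) : Slice (Σ i, Ω' i) k → ℝ :=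
  homogenization μ ᵥ* down (Σ i, Ω' i) n k

end DownUp

/-! A random point of level `j + 1` is a uniform set S of `j + 1` coordinates together with the
restriction to S of a `μ`-random configuration. Let g be a density at this level and m(S) its mean
over configurations. The divergence of g splits into the average over S of the φ-entropy of g(S, ·)
and the divergence of m on the Johnson scheme of coordinate sets. One down step contracts both
parts.

Configuration part: the contraction of `down` from n to n - 1 is approximate tensorization. Applied
to functions of the coordinates in S alone (`Contracts.entropy_restrict_le`), it bounds the entropy
of g(S, ·) by C(j + 1) times the average loss when one coordinate of S is averaged out. Forgetting
which coordinate was removed averages functions, and φ-entropy is convex in the function, so this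
part shrinks by 1 - 1/(C(j + 1)).

Set part (`EntropyFunction.levelAvg_upAvg_le`): an inequality between three consecutive levels
follows from a bound for random pairs in each link, and induction on the level gives the factor 1 -
n/((j + 1)(n - j)) for χ² and 1 - 1/(j + 1) for KL. The pair bound for KL uses the tangent of x log
x at the product prediction h(y)h(z)/c; for χ² it uses the square of the non-additive component.

The stated rate is at most the rate of either part, so it applies to their sum
(`Contracts.down_succ`). Single steps multiply, and the up operator is handled by data processing.
`EntropyFunction` collects what is used about φ, so both divergences share one argument. -/

namespace DownUp

open scoped Matrix

/-! ### Kernels and data processing -/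

section Kernel

variable {α β : Type*} [Fintype α]

theorem vecMul_nonneg {ν : α → ℝ} {P : Matrix α β ℝ} (hν : ∀ x, 0 ≤ ν x)
    (hP : ∀ x y, 0 ≤ P x y) (y : β) : 0 ≤ (ν ᵥ* P) y :=
  Finset.sum_nonneg fun x _ => mul_nonneg (hν x) (hP x y)

theorem vecMul_mem_stdSimplex [Fintype β] {ν : α → ℝ} {P : Matrix α β ℝ} (hν : ν ∈ stdSimplex ℝ α)
    (hP : ∀ x y, 0 ≤ P x y) (hP' : ∀ x, ∑ y, P x y = 1) : ν ᵥ* P ∈ stdSimplex ℝ β := by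
  refine ⟨vecMul_nonneg hν.1 hP, ?_⟩
  simp only [Matrix.vecMul, dotProduct]
  rw [Finset.sum_comm]
  simp_rw [← Finset.mul_sum, hP', mul_one]
  exact hν.2

/-- Absolute continuity is preserved by nonnegative kernels. -/
theorem vecMul_eq_zero_of_eq_zero {μ ν : α → ℝ} {P : Matrix α β ℝ} (hμ : ∀ x, 0 ≤ μ x)
    (hP : ∀ x y, 0 ≤ P x y) (hνμ : ∀ x, μ x = 0 → ν x = 0) (y : β) (hy : (μ ᵥ* P) y = 0) :
    (ν ᵥ* P) y = 0 := by
  refine Finset.sum_eq_zero fun x _ => ?_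
  have h := (Finset.sum_eq_zero_iff_of_nonneg
    (fun x _ => mul_nonneg (hμ x) (hP x y))).1 hy x (Finset.mem_univ x)
  rcases mul_eq_zero.1 h with h | h
  · rw [hνμ x h, zero_mul]
  · exact mul_eq_zero_of_right _ h

/-- The data processing inequality for convex `f`-divergences. -/
theorem fDiv_vecMul_le [Fintype β] {f : ℝ → ℝ} (hf : ConvexOn ℝ (Set.Ici 0) f) {μ ν : α → ℝ}
    {P : Matrix α β ℝ} (hμ : ∀ x, 0 ≤ μ x) (hν : ∀ x, 0 ≤ ν x) (hP : ∀ x y, 0 ≤ P x y)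
    (hP' : ∀ x, μ x ≠ 0 → ∑ y, P x y = 1) (hνμ : ∀ x, μ x = 0 → ν x = 0) :
    fDiv f (ν ᵥ* P) (μ ᵥ* P) ≤ fDiv f ν μ := by
  have key : ∀ y, (μ ᵥ* P) y * f ((ν ᵥ* P) y / (μ ᵥ* P) y)
      ≤ ∑ x, μ x * P x y * f (ν x / μ x) := by
    intro y
    have h0 : ∀ x ∈ Finset.univ, 0 ≤ μ x * P x y := fun x _ => mul_nonneg (hμ x) (hP x y)
    rcases (vecMul_nonneg hμ hP y).eq_or_lt with h | h
    · have h' := (Finset.sum_eq_zero_iff_of_nonneg h0).1 h.symm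
      rw [← h, zero_mul, Finset.sum_eq_zero]
      intro x hx
      rw [h' x hx, zero_mul]
    -- Jensen for the posterior law of x given y, whose unnormalized weights are `μ x * P x y`.
    · have hj := hf.map_centerMass_le (t := Finset.univ) (w := fun x => μ x * P x y)
        (p := fun x => ν x / μ x) h0 h (fun x _ => div_nonneg (hν x) (hμ x))
      have e : (ν ᵥ* P) y = ∑ x, μ x * P x y * (ν x / μ x) := by
        refine Finset.sum_congr rfl fun x _ => ?_
        by_cases hx : μ x = 0
        · rw [hνμ x hx, hx]; simp
        · field_simp
      have e2 : (μ ᵥ* P) y = ∑ x, μ x * P x y := rfl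
      simp only [Finset.centerMass, smul_eq_mul, Function.comp_apply] at hj
      rw [← e, ← e2, inv_mul_eq_div, inv_mul_eq_div, le_div_iff₀ h] at hj
      linarith
  calc fDiv f (ν ᵥ* P) (μ ᵥ* P) ≤ ∑ y, ∑ x, μ x * P x y * f (ν x / μ x) :=
        Finset.sum_le_sum fun y _ => key y
    _ = ∑ x, μ x * f (ν x / μ x) * ∑ y, P x y := by
        rw [Finset.sum_comm]
        refine Finset.sum_congr rfl fun x _ => ?_
        rw [Finset.mul_sum]
        exact Finset.sum_congr rfl fun y _ => by ring
    _ = fDiv f ν μ := by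
        refine Finset.sum_congr rfl fun x _ => ?_
        by_cases hx : μ x = 0
        · simp [hx]
        · rw [hP' x hx, mul_one]

end Kernel

/-! ### Conditional means on finite weighted sets -/

section CondMean

variable {X Y Z : Type*} [Fintype X] [DecidableEq Y] [DecidableEq Z]

/-- The conditional mean of `u` given `π` under the weights `μ` on a finite set. -/
noncomputable def condMean (μ : X → ℝ) (π : X → Y) (u : X → ℝ) (x : X) : ℝ :=
  (∑ y with π y = π x, μ y * u y) / ∑ y with π y = π x, μ y

variable {μ : X → ℝ}

theorem fiberSum_pos (hμ : ∀ x, 0 ≤ μ x) (π : X → Y) {x : X} (hx : μ x ≠ 0) : 0 < ∑ y with π y = π x, μ y :=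
  Finset.sum_pos' (fun y _ => hμ y) ⟨x, by simp, lt_of_le_of_ne (hμ x) hx.symm⟩

theorem condMean_nonneg (hμ : ∀ x, 0 ≤ μ x) (π : X → Y) {u : X → ℝ} (hu : ∀ x, 0 ≤ u x) (x : X) :
    0 ≤ condMean μ π u x :=
  div_nonneg (Finset.sum_nonneg fun y _ => mul_nonneg (hμ y) (hu y))
    (Finset.sum_nonneg fun y _ => hμ y)

/-- The defining property of conditional expectation. After exchanging sums, the fiber weight
cancels; null fibers, where division by zero gives 0, carry no mass. -/
theorem sum_condMean_mul (hμ : ∀ x, 0 ≤ μ x) (π : X → Y) (u : X → ℝ) (v : Y → ℝ) :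
    ∑ x, μ x * condMean μ π u x * v (π x) = ∑ x, μ x * u x * v (π x) := by
  have e : ∀ x, μ x * condMean μ π u x * v (π x)
      = ∑ y, if π y = π x then μ x / (∑ z with π z = π y, μ z) * (μ y * u y * v (π y)) else 0 := by
    intro x
    rw [condMean, Finset.sum_filter, Finset.sum_div, Finset.mul_sum, Finset.sum_mul]
    refine Finset.sum_congr rfl fun y _ => ?_
    split_ifs with h
    · rw [h]; ring
    · simp
  simp_rw [e]
  rw [Finset.sum_comm]
  refine Finset.sum_congr rfl fun y _ => ?_
  rw [← Finset.sum_filter, ← Finset.sum_mul, ← Finset.sum_div]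
  have e2 : (Finset.univ.filter fun x => π y = π x) = Finset.univ.filter fun x => π x = π y := by
    ext; simp [eq_comm]
  rw [e2]
  by_cases hy : μ y = 0
  · simp [hy]
  · rw [div_self (fiberSum_pos hμ π hy).ne', one_mul]

theorem sum_condMean (hμ : ∀ x, 0 ≤ μ x) (π : X → Y) (u : X → ℝ) :
    ∑ x, μ x * condMean μ π u x = ∑ x, μ x * u x := by
  simpa using sum_condMean_mul hμ π u fun _ => 1

theorem sum_map_condMean_le (hμ : ∀ x, 0 ≤ μ x)
    {φ : ℝ → ℝ} (hφ : ConvexOn ℝ (Set.Ici 0) φ) (π : X → Y) {u : X → ℝ}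
    (hu : ∀ x, 0 ≤ u x) : ∑ x, μ x * φ (condMean μ π u x) ≤ ∑ x, μ x * φ (u x) := by
  rw [← sum_condMean hμ π fun x => φ (u x)]
  refine Finset.sum_le_sum fun x _ => ?_
  by_cases hx : μ x = 0
  · simp [hx]
  · have hj := hφ.map_centerMass_le (t := Finset.univ.filter fun y => π y = π x) (w := μ)
      (p := u) (fun y _ => hμ y) (fiberSum_pos hμ π hx) (fun y _ => hu y)
    simp only [Finset.centerMass, smul_eq_mul, Function.comp_apply, inv_mul_eq_div] at hj
    exact mul_le_mul_of_nonneg_left hj (hμ x)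

theorem condMean_condMean (hμ : ∀ x, 0 ≤ μ x) (π : X → Y) (f : Y → Z) (u : X → ℝ) (x : X) :
    condMean μ (f ∘ π) (condMean μ π u) x = condMean μ (f ∘ π) u x := by
  unfold condMean
  congr 1
  have := sum_condMean_mul hμ π u fun y => if f y = f (π x) then 1 else 0
  simpa [Finset.sum_filter, condMean] using this

/-- By the tower property the coarser conditional mean is a conditional mean of the finer one, so
Jensen applies. -/
theorem sum_map_condMean_mono (hμ : ∀ x, 0 ≤ μ x)
    {φ : ℝ → ℝ} (hφ : ConvexOn ℝ (Set.Ici 0) φ) {π : X → Y} {π' : X → Z}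
    {f : Y → Z} (h : π' = f ∘ π) {u : X → ℝ} (hu : ∀ x, 0 ≤ u x) :
    ∑ x, μ x * φ (condMean μ π' u x) ≤ ∑ x, μ x * φ (condMean μ π u x) := by
  subst h
  rw [← funext (condMean_condMean hμ π f u)]
  exact sum_map_condMean_le hμ hφ _ (condMean_nonneg hμ π hu)

theorem condMean_comp (hμ : ∀ x, 0 ≤ μ x) (π : X → Y) (w : Y → ℝ) {x : X} (hx : μ x ≠ 0) :
    condMean μ π (w ∘ π) x = w (π x) := by
  have e : ∑ y with π y = π x, μ y * (w ∘ π) y = (∑ y with π y = π x, μ y) * w (π x) := by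
    rw [Finset.sum_mul]
    refine Finset.sum_congr rfl fun y hy => ?_
    rw [Function.comp_apply, (Finset.mem_filter.1 hy).2]
  rw [condMean, e, mul_div_cancel_left₀ _ (fiberSum_pos hμ π hx).ne']

end CondMean

/-! ### Convexity of the two functions and of their entropies -/

theorem tangent_mul_log {a b : ℝ} (ha : 0 ≤ a) (hb : 0 ≤ b) (h : b = 0 → a = 0) :
    a * Real.log b + a - b ≤ a * Real.log a := by
  rcases ha.eq_or_lt with rfl | ha
  · simp [hb]
  have hb : 0 < b := hb.lt_of_ne fun e => ha.ne' (h e.symm)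
  have h1 := Real.log_le_sub_one_of_pos (div_pos hb ha)
  rw [Real.log_div hb.ne' ha.ne'] at h1
  have h2 := mul_le_mul_of_nonneg_left h1 ha.le
  have h3 : a * (b / a - 1) = b - a := by field_simp
  linarith

theorem convexOn_klFun : ConvexOn ℝ (Set.Ici 0) klFun := Real.convexOn_mul_log

theorem convexOn_chiSqFun : ConvexOn ℝ (Set.Ici 0) chiSqFun := by
  refine ⟨convex_Ici 0, fun x _ y _ a b ha hb hab => ?_⟩
  simp only [chiSqFun, smul_eq_mul]
  obtain rfl : b = 1 - a := by linarith
  nlinarith [mul_nonneg (mul_nonneg ha hb) (sq_nonneg (x - y))]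

section JointConvexity

variable {X ι : Type*} [Fintype X]

/-- Joint convexity of a log(a/b): bound each a log a below by its tangent at (A/B)b. The linear
corrections cancel on summation, since A/B is the ratio of the two totals. -/
theorem log_sum_inequality (s : Finset ι) {a b : ι → ℝ} (ha : ∀ i ∈ s, 0 ≤ a i)
    (hb : ∀ i ∈ s, 0 ≤ b i) (h : ∀ i ∈ s, b i = 0 → a i = 0) {A B : ℝ} {N : ℝ} (hN : 0 < N)
    (hA : A = (∑ i ∈ s, a i) / N) (hB : B = (∑ i ∈ s, b i) / N) :
    A * Real.log A - A * Real.log B ≤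
      (∑ i ∈ s, (a i * Real.log (a i) - a i * Real.log (b i))) / N := by
  have hA0 : 0 ≤ A := hA ▸ div_nonneg (Finset.sum_nonneg ha) hN.le
  have hB0 : 0 ≤ B := hB ▸ div_nonneg (Finset.sum_nonneg hb) hN.le
  have hA' : ∑ i ∈ s, a i = A * N := by rw [hA]; field_simp
  have hB' : ∑ i ∈ s, b i = B * N := by rw [hB]; field_simp
  rw [le_div_iff₀ hN]
  rcases hA0.eq_or_lt with h0 | hApos
  · have : ∀ i ∈ s, a i = 0 := by
      rw [← h0, zero_mul] at hA'
      exact (Finset.sum_eq_zero_iff_of_nonneg ha).1 hA'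
    rw [← h0, Finset.sum_eq_zero fun i hi => by rw [this i hi]; simp]
    simp
  have hBpos : 0 < B := by
    refine hB0.lt_of_ne fun e => ?_
    rw [← e, zero_mul] at hB'
    have hb0 := (Finset.sum_eq_zero_iff_of_nonneg hb).1 hB'
    have := Finset.sum_eq_zero fun i hi => h i hi (hb0 i hi)
    rw [this] at hA'
    exact (mul_pos hApos hN).ne hA'
  have key : ∀ i ∈ s, a i * Real.log A - a i * Real.log B + a i - A / B * b i
      ≤ a i * Real.log (a i) - a i * Real.log (b i) := by
    intro i hi
    by_cases hbi : b i = 0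
    · simp [h i hi hbi, hbi]
    · have ht := tangent_mul_log (ha i hi) (mul_nonneg (div_pos hApos hBpos).le (hb i hi))
        (fun e => by
          rcases mul_eq_zero.1 e with e | e
          · exact absurd e (div_pos hApos hBpos).ne'
          · exact absurd e hbi)
      rw [Real.log_mul (div_pos hApos hBpos).ne' hbi, Real.log_div hApos.ne' hBpos.ne'] at ht
      linarith
  refine le_trans (le_of_eq ?_) (Finset.sum_le_sum key)
  rw [Finset.sum_sub_distrib, Finset.sum_add_distrib, Finset.sum_sub_distrib, ← Finset.sum_mul,
    ← Finset.sum_mul, ← Finset.mul_sum, hA', hB']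
  field_simp
  ring

/-- The entropy of the average of finitely many functions is at most the average of their
entropies. -/
theorem klFun_entropy_average_le {p : X → ℝ} (hp : p ∈ stdSimplex ℝ X) (s : Finset ι)
    (hs : s.Nonempty) (u : ι → X → ℝ) (hu : ∀ i x, 0 ≤ u i x) :
    ∑ x, p x * klFun ((∑ i ∈ s, u i x) / s.card)
        - klFun ((∑ i ∈ s, ∑ x, p x * u i x) / s.card)
      ≤ (∑ i ∈ s, (∑ x, p x * klFun (u i x) - klFun (∑ x, p x * u i x))) / s.card := by
  have hN : (0 : ℝ) < s.card := by exact_mod_cast hs.card_pos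
  set b : ι → ℝ := fun i => ∑ x, p x * u i x with hb
  have hb0 : ∀ i, 0 ≤ b i := fun i => Finset.sum_nonneg fun x _ => mul_nonneg (hp.1 x) (hu i x)
  set B := (∑ i ∈ s, b i) / s.card with hB
  have hbar : ∑ x, p x * ((∑ i ∈ s, u i x) / s.card) = B := by
    simp_rw [hB, hb, ← mul_div_assoc, ← Finset.sum_div, Finset.mul_sum]
    rw [Finset.sum_comm]
  have key : ∀ x, p x * (klFun ((∑ i ∈ s, u i x) / s.card)
        - (∑ i ∈ s, u i x) / s.card * Real.log B)
      ≤ p x * ((∑ i ∈ s, (klFun (u i x) - u i x * Real.log (b i))) / s.card) := by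
    intro x
    by_cases hx : p x = 0
    · simp [hx]
    refine mul_le_mul_of_nonneg_left ?_ (hp.1 x)
    -- A zero mean `b i` forces `u i x = 0` only where `p x ≠ 0`, hence the case split.
    refine log_sum_inequality s (fun i _ => hu i x) (fun i _ => hb0 i) (fun i _ hi => ?_) hN rfl hB
    have := (Finset.sum_eq_zero_iff_of_nonneg
      (fun x _ => mul_nonneg (hp.1 x) (hu i x))).1 hi x (Finset.mem_univ x)
    exact (mul_eq_zero.1 this).resolve_left hx
  have hsum := Finset.sum_le_sum fun x (_ : x ∈ Finset.univ) => key x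
  refine le_trans (le_of_eq ?_) (hsum.trans (le_of_eq ?_))
  · simp_rw [mul_sub, Finset.sum_sub_distrib, ← mul_assoc, ← Finset.sum_mul]
    rw [hbar, klFun]
  · simp_rw [← mul_div_assoc, ← Finset.sum_div, Finset.mul_sum]
    rw [Finset.sum_comm]
    congr 1
    refine Finset.sum_congr rfl fun i _ => ?_
    simp_rw [mul_sub, Finset.sum_sub_distrib, ← mul_assoc, ← Finset.sum_mul]
    rfl

/-- The shift by 1 in `chiSqFun` drops out, leaving the variance. Convexity in the function thus
reduces to Cauchy–Schwarz at each point. -/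
theorem chiSqFun_entropy_eq {p : X → ℝ} (hp : ∑ x, p x = 1) (u : X → ℝ) :
    ∑ x, p x * chiSqFun (u x) - chiSqFun (∑ x, p x * u x)
      = ∑ x, p x * (u x - ∑ y, p y * u y) ^ 2 := by
  set b := ∑ x, p x * u x with hb
  have e : ∀ x, p x * chiSqFun (u x) = p x * (u x - b) ^ 2 + (p x * u x) * (2 * (b - 1))
      + p x * (1 - b ^ 2) := by
    intro x; simp only [chiSqFun]; ring
  simp_rw [e, Finset.sum_add_distrib, ← Finset.sum_mul]
  rw [hp, ← hb, chiSqFun]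
  ring

theorem chiSqFun_entropy_average_le {p : X → ℝ} (hp : p ∈ stdSimplex ℝ X) (s : Finset ι)
    (hs : s.Nonempty) (u : ι → X → ℝ) :
    ∑ x, p x * chiSqFun ((∑ i ∈ s, u i x) / s.card)
        - chiSqFun ((∑ i ∈ s, ∑ x, p x * u i x) / s.card)
      ≤ (∑ i ∈ s, (∑ x, p x * chiSqFun (u i x) - chiSqFun (∑ x, p x * u i x))) / s.card := by
  have hN : (0 : ℝ) < s.card := by exact_mod_cast hs.card_pos
  have hbar : (∑ i ∈ s, ∑ x, p x * u i x) / s.card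
      = ∑ x, p x * ((∑ i ∈ s, u i x) / s.card) := by
    simp_rw [← mul_div_assoc, ← Finset.sum_div, Finset.mul_sum]
    rw [Finset.sum_comm]
  rw [hbar, chiSqFun_entropy_eq hp.2, ← hbar]
  simp_rw [chiSqFun_entropy_eq hp.2]
  rw [Finset.sum_comm (t := Finset.univ) (f := fun i x => p x * (u i x - ∑ y, p y * u i y) ^ 2),
    Finset.sum_div _ fun x => ∑ i ∈ s, p x * (u i x - ∑ y, p y * u i y) ^ 2]
  refine Finset.sum_le_sum fun x _ => ?_
  rw [← Finset.mul_sum, mul_div_assoc]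
  refine mul_le_mul_of_nonneg_left ?_ (hp.1 x)
  rw [← sub_div, ← Finset.sum_sub_distrib, div_pow, le_div_iff₀ hN, div_mul_eq_mul_div,
    div_le_iff₀ (by positivity)]
  have := mul_le_mul_of_nonneg_right
    (sq_sum_le_card_mul_sum_sq (s := s) (f := fun i => u i x - ∑ x, p x * u i x)) hN.le
  linarith

end JointConvexity

/-! ### Homogeneity of the entropies: degree 1 for KL, degree 2 for χ² -/

section Scale

variable {X : Type*} [Fintype X]

theorem klFun_entropy_smul {c : ℝ} (hc : 0 < c) {p u : X → ℝ} (hu : 0 < ∑ x, p x * u x) :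
    ∑ x, p x * klFun (c * u x) - klFun (∑ x, p x * (c * u x))
      = c * (∑ x, p x * klFun (u x) - klFun (∑ x, p x * u x)) := by
  have e : ∀ x, p x * klFun (c * u x) = c * (p x * klFun (u x)) + c * Real.log c * (p x * u x) := by
    intro x
    by_cases h : u x = 0
    · simp [h, klFun]
    · rw [klFun, klFun, Real.log_mul hc.ne' h]; ring
  have e2 : ∑ x, p x * (c * u x) = c * ∑ x, p x * u x := by
    rw [Finset.mul_sum]; exact Finset.sum_congr rfl fun x _ => by ring
  simp_rw [e, Finset.sum_add_distrib, ← Finset.mul_sum]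
  rw [e2, klFun, klFun, Real.log_mul hc.ne' hu.ne']
  ring

theorem chiSqFun_entropy_smul (c : ℝ) {p : X → ℝ} (hp : ∑ x, p x = 1) (u : X → ℝ) :
    ∑ x, p x * chiSqFun (c * u x) - chiSqFun (∑ x, p x * (c * u x))
      = c ^ 2 * (∑ x, p x * chiSqFun (u x) - chiSqFun (∑ x, p x * u x)) := by
  have e2 : ∑ x, p x * (c * u x) = c * ∑ x, p x * u x := by
    rw [Finset.mul_sum]; exact Finset.sum_congr rfl fun x _ => by ring
  rw [chiSqFun_entropy_eq hp, chiSqFun_entropy_eq hp, e2, Finset.mul_sum (a := c ^ 2)]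
  exact Finset.sum_congr rfl fun x _ => by ring

end Scale

/-! ### Entropy inequalities for uniformly random pairs -/

section Pair

variable {ι : Type*} [DecidableEq ι]

theorem sum_erase_swap (s : Finset ι) (F : ι → ι → ℝ) :
    ∑ y ∈ s, ∑ z ∈ s.erase y, F z y = ∑ y ∈ s, ∑ z ∈ s.erase y, F y z := by
  refine Finset.sum_comm' fun x y => ?_
  simp only [Finset.mem_erase, ne_eq]
  tauto

theorem sum_erase_mul (s : Finset ι) (h : ι → ℝ) :
    ∑ y ∈ s, ∑ z ∈ s.erase y, h y * h z = (∑ y ∈ s, h y) ^ 2 - ∑ y ∈ s, h y ^ 2 := by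
  rw [sq, Finset.sum_mul, ← Finset.sum_sub_distrib]
  refine Finset.sum_congr rfl fun y hy => ?_
  rw [← Finset.mul_sum, ← Finset.add_sum_erase s h hy]
  ring

theorem sum_erase_const {s : Finset ι} {m : ℕ} (hs : s.card = m + 2) (F : ι → ℝ) :
    ∑ y ∈ s, ∑ _z ∈ s.erase y, F y = (m + 1) * ∑ y ∈ s, F y := by
  rw [Finset.mul_sum]
  refine Finset.sum_congr rfl fun y hy => ?_
  rw [Finset.sum_const, Finset.card_erase_of_mem hy, hs]
  simp

/-- The tangent of x log x at h(y)h(z)/c is summed over ordered pairs. The logarithms reproduce the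
entropies of h and c; the linear terms have the right sign because, by Cauchy–Schwarz, the sum of
h(y)h(z) over distinct pairs is at most (m + 1)(m + 2)c². -/
theorem klFun_pair_le {s : Finset ι} {m : ℕ} (hs : s.card = m + 2) {w : ι → ι → ℝ}
    (hw : ∀ y z, 0 ≤ w y z) (hsymm : ∀ y z, w y z = w z y) {h : ι → ℝ} {c : ℝ}
    (hh : ∀ y ∈ s, h y = (∑ z ∈ s.erase y, w y z) / (m + 1))
    (hc : c = (∑ y ∈ s, h y) / (m + 2)) :
    2 * ((∑ y ∈ s, klFun (h y)) / (m + 2)) ≤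
      (∑ y ∈ s, (∑ z ∈ s.erase y, klFun (w y z)) / (m + 1)) / (m + 2) + klFun c := by
  have hm1 : (0 : ℝ) < m + 1 := by positivity
  have hm2 : (0 : ℝ) < m + 2 := by positivity
  have hh0 : ∀ y ∈ s, 0 ≤ h y := fun y hy =>
    hh y hy ▸ div_nonneg (Finset.sum_nonneg fun z _ => hw y z) hm1.le
  have hw0 : ∀ y ∈ s, h y = 0 → ∀ z ∈ s.erase y, w y z = 0 := by
    intro y hy h0
    rw [hh y hy, div_eq_zero_iff, or_iff_left hm1.ne'] at h0
    exact (Finset.sum_eq_zero_iff_of_nonneg fun z _ => hw y z).1 h0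
  have hH : ∑ y ∈ s, h y = (m + 2) * c := by rw [hc]; field_simp
  have hc0 : 0 ≤ c := hc ▸ div_nonneg (Finset.sum_nonneg hh0) hm2.le
  rcases hc0.eq_or_lt with h0 | hcpos
  · rw [← h0, mul_zero] at hH
    have hz := (Finset.sum_eq_zero_iff_of_nonneg hh0).1 hH
    have e1 : ∑ y ∈ s, klFun (h y) = 0 :=
      Finset.sum_eq_zero fun y hy => by rw [hz y hy]; simp [klFun]
    have e2 : ∑ y ∈ s, (∑ z ∈ s.erase y, klFun (w y z)) / ((m : ℝ) + 1) = 0 :=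
      Finset.sum_eq_zero fun y hy => by
        rw [Finset.sum_eq_zero, zero_div]
        intro z hz'
        rw [hw0 y hy (hz y hy) z hz']
        simp [klFun]
    rw [e1, e2, ← h0]
    simp [klFun]
  have key : ∀ y ∈ s, ∀ z ∈ s.erase y, w y z * Real.log (h y) + w y z * Real.log (h z)
      - w y z * Real.log c + w y z - h y * h z / c ≤ klFun (w y z) := by
    intro y hy z hz
    have hz' := Finset.mem_of_mem_erase hz
    have hnn : 0 ≤ h y * h z / c := div_nonneg (mul_nonneg (hh0 y hy) (hh0 z hz')) hc0
    by_cases h0 : w y z = 0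
    · simp [h0, klFun, hnn]
    · have hy0 : h y ≠ 0 := fun e => h0 (hw0 y hy e z hz)
      have hz0 : h z ≠ 0 := fun e => h0 (by
        rw [hsymm]
        exact hw0 z hz' e y (Finset.mem_erase.2 ⟨(Finset.ne_of_mem_erase hz).symm, hy⟩))
      have := tangent_mul_log (hw y z) hnn fun e => absurd e (by positivity)
      rw [Real.log_div (mul_ne_zero hy0 hz0) hcpos.ne', Real.log_mul hy0 hz0] at this
      rw [klFun]
      linarith
  have hsumw : ∀ y ∈ s, ∑ z ∈ s.erase y, w y z = (m + 1) * h y := by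
    intro y hy; rw [hh y hy]; field_simp
  have s1 : ∑ y ∈ s, ∑ z ∈ s.erase y, w y z * Real.log (h y)
      = (m + 1) * ∑ y ∈ s, klFun (h y) := by
    rw [Finset.mul_sum]
    refine Finset.sum_congr rfl fun y hy => ?_
    rw [← Finset.sum_mul, hsumw y hy, klFun]; ring
  have s2 : ∑ y ∈ s, ∑ z ∈ s.erase y, w y z * Real.log (h z)
      = (m + 1) * ∑ y ∈ s, klFun (h y) := by
    rw [← s1, ← sum_erase_swap]
    simp_rw [hsymm]
  have s3 : ∑ y ∈ s, ∑ z ∈ s.erase y, w y z = (m + 1) * ((m + 2) * c) := by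
    rw [← hH, Finset.mul_sum]
    exact Finset.sum_congr rfl hsumw
  have s4 : ∑ y ∈ s, ∑ z ∈ s.erase y, h y * h z ≤ (m + 1) * (m + 2) * c ^ 2 := by
    rw [sum_erase_mul, hH]
    have := sq_sum_le_card_mul_sum_sq (s := s) (f := h)
    rw [hH, hs] at this
    push_cast at this
    have h2 : (m + 2) * c ^ 2 ≤ ∑ y ∈ s, h y ^ 2 := by
      refine le_of_mul_le_mul_left ?_ hm2
      linarith
    linarith
  have hsum := Finset.sum_le_sum fun y hy => Finset.sum_le_sum fun z hz => key y hy z hz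
  simp_rw [Finset.sum_sub_distrib, Finset.sum_add_distrib, Finset.sum_sub_distrib,
    Finset.sum_add_distrib, ← Finset.sum_mul, ← Finset.sum_div] at hsum
  simp_rw [← Finset.sum_mul] at s1 s2
  rw [s3] at hsum
  have s5 : (∑ y ∈ s, ∑ z ∈ s.erase y, h y * h z) / c ≤ (m + 1) * (m + 2) * c := by
    rw [div_le_iff₀ hcpos]; linarith
  rw [← Finset.sum_div, div_div, ← sub_nonneg]
  have : 0 ≤ (((m : ℝ) + 1) * (m + 2))⁻¹ * (∑ y ∈ s, ∑ z ∈ s.erase y, klFun (w y z)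
      - 2 * (m + 1) * ∑ y ∈ s, klFun (h y) + (m + 1) * (m + 2) * klFun c) := by
    refine mul_nonneg (by positivity) ?_
    have hk : klFun c = c * Real.log c := rfl
    rw [hk]
    linarith
  refine this.trans (le_of_eq ?_)
  field_simp
  ring

/-- The difference of the two sides is, up to a positive factor, the squared norm of the part of w
orthogonal to all functions of the form a(y) + a(z). -/
theorem sq_pair_le {s : Finset ι} {m : ℕ} (hs : s.card = m + 2) {w : ι → ι → ℝ}
    (hsymm : ∀ y z, w y z = w z y) {h : ι → ℝ} {c : ℝ}
    (hh : ∀ y ∈ s, h y = (∑ z ∈ s.erase y, w y z) / (m + 1))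
    (hc : c = (∑ y ∈ s, h y) / (m + 2)) :
    2 * (m + 1) * ((∑ y ∈ s, h y ^ 2) / (m + 2)) ≤
      m * ((∑ y ∈ s, (∑ z ∈ s.erase y, w y z ^ 2) / (m + 1)) / (m + 2)) + (m + 2) * c ^ 2 := by
  have hm1 : (0 : ℝ) < m + 1 := by positivity
  have hm2 : (0 : ℝ) < m + 2 := by positivity
  have hH : ∑ y ∈ s, h y = (m + 2) * c := by rw [hc]; field_simp
  -- The final normalization divides by m. For m = 0 there is a single unordered pair, h is
  -- constantly c, and equality holds.
  rcases Nat.eq_zero_or_pos m with rfl | hm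
  · obtain ⟨a, b, hab, rfl⟩ := Finset.card_eq_two.1 hs
    have ea : ({a, b} : Finset ι).erase a = {b} := by
      ext x; simp only [Finset.mem_erase, Finset.mem_insert, Finset.mem_singleton]
      constructor
      · tauto
      · rintro rfl; exact ⟨hab.symm, Or.inr rfl⟩
    have eb : ({a, b} : Finset ι).erase b = {a} := by
      ext x; simp only [Finset.mem_erase, Finset.mem_insert, Finset.mem_singleton]
      constructor
      · tauto
      · rintro rfl; exact ⟨hab, Or.inl rfl⟩
    have ha := hh a (by simp)
    have hb := hh b (by simp)
    rw [ea, Finset.sum_singleton] at ha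
    rw [eb, Finset.sum_singleton, hsymm] at hb
    rw [Finset.sum_pair hab] at hH ⊢
    have : h a = h b := by rw [ha, hb]
    rw [← this] at hH ⊢
    push_cast at hH ⊢
    have : h a = c := by linarith
    rw [this]
    linarith
  have hmpos : (0 : ℝ) < m := by exact_mod_cast hm
  have hsumw : ∀ y ∈ s, ∑ z ∈ s.erase y, w y z = (m + 1) * h y := by
    intro y hy; rw [hh y hy]; field_simp
  have s1 : ∑ y ∈ s, ∑ z ∈ s.erase y, w y z * h y = (m + 1) * ∑ y ∈ s, h y ^ 2 := by
    rw [Finset.mul_sum]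
    refine Finset.sum_congr rfl fun y hy => ?_
    rw [← Finset.sum_mul, hsumw y hy]; ring
  have s2 : ∑ y ∈ s, ∑ z ∈ s.erase y, w y z * h z = (m + 1) * ∑ y ∈ s, h y ^ 2 := by
    rw [← s1, ← sum_erase_swap]
    simp_rw [hsymm]
  have s3 : ∑ y ∈ s, ∑ z ∈ s.erase y, w y z = (m + 1) * ((m + 2) * c) := by
    rw [← hH, Finset.mul_sum]
    exact Finset.sum_congr rfl hsumw
  have s4 := sum_erase_mul s h
  rw [hH] at s4
  have s5 := sum_erase_const hs h
  rw [hH] at s5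
  have s6 : ∑ y ∈ s, ∑ z ∈ s.erase y, h z = (m + 1) * ((m + 2) * c) := by
    rw [← s5]; exact (sum_erase_swap s fun y _ => h y)
  have s7 := sum_erase_const hs fun y => h y ^ 2
  have s8 : ∑ y ∈ s, ∑ z ∈ s.erase y, h z ^ 2 = (m + 1) * ∑ y ∈ s, h y ^ 2 := by
    rw [← s7]; exact (sum_erase_swap s fun y _ => h y ^ 2)
  have s9 := sum_erase_const hs fun _ => (1 : ℝ)
  rw [Finset.sum_const, hs] at s9
  -- The squared expression is m times the residual of w after subtracting its additive projection c
  -- + ((m + 1)/m)((h(y) - c) + (h(z) - c)).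
  have hpos : 0 ≤ ∑ y ∈ s, ∑ z ∈ s.erase y,
      (m * w y z - (m + 1) * (h y + h z) + (m + 2) * c) ^ 2 :=
    Finset.sum_nonneg fun y _ => Finset.sum_nonneg fun z _ => sq_nonneg _
  have e : ∀ y z, (m * w y z - (m + 1) * (h y + h z) + (m + 2) * c) ^ 2
      = m ^ 2 * w y z ^ 2 + (m + 1) ^ 2 * h y ^ 2 + (m + 1) ^ 2 * h z ^ 2
        + 2 * (m + 1) ^ 2 * (h y * h z) + (m + 2) ^ 2 * c ^ 2 * 1
        + (-2 * m * (m + 1)) * (w y z * h y) + (-2 * m * (m + 1)) * (w y z * h z)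
        + (2 * m * (m + 2) * c) * w y z + (-2 * (m + 1) * (m + 2) * c) * h y
        + (-2 * (m + 1) * (m + 2) * c) * h z := by
    intro y z; ring
  simp_rw [e, Finset.sum_add_distrib, ← Finset.mul_sum] at hpos
  simp_rw [← Finset.mul_sum] at s4
  rw [s1, s2, s3, s4, s5, s6, s7, s8, s9] at hpos
  rw [← Finset.sum_div, div_div, ← sub_nonneg]
  refine le_trans (mul_nonneg (a := ((m : ℝ) * (m + 1) * (m + 2))⁻¹) (by positivity) hpos)
    (le_of_eq ?_)
  field_simp
  ring

theorem chiSqFun_pair_le {s : Finset ι} {m : ℕ} (hs : s.card = m + 2) {w : ι → ι → ℝ}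
    (hsymm : ∀ y z, w y z = w z y) {h : ι → ℝ} {c : ℝ}
    (hh : ∀ y ∈ s, h y = (∑ z ∈ s.erase y, w y z) / (m + 1))
    (hc : c = (∑ y ∈ s, h y) / (m + 2)) :
    2 * (m + 1) * ((∑ y ∈ s, chiSqFun (h y)) / (m + 2)) ≤
      m * ((∑ y ∈ s, (∑ z ∈ s.erase y, chiSqFun (w y z)) / (m + 1)) / (m + 2))
        + (m + 2) * chiSqFun c := by
  refine sq_pair_le hs (w := fun y z => w y z - 1) (fun y z => by rw [hsymm]) ?_ ?_
  · intro y hy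
    rw [Finset.sum_sub_distrib, Finset.sum_const, Finset.card_erase_of_mem hy, hs, hh y hy]
    push_cast [Nat.add_succ_sub_one]
    field_simp
    simp
  · rw [Finset.sum_sub_distrib, Finset.sum_const, hs, hc]
    field_simp
    simp

end Pair

-- The common interface for the two divergences

universe u

/-- The properties of an entropy function `φ` that the local-to-global argument uses: convexity,
homogeneity of the `φ`-entropy `E φ(u) - φ(E u)` in `u` and its convexity in `u`, and a
contraction inequality for uniformly random pairs, with weights `γ`. -/
structure EntropyFunction (φ : ℝ → ℝ) (γ : ℕ → ℝ) : Prop where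
  convexOn : ConvexOn ℝ (Set.Ici 0) φ
  map_one : φ 1 = 0
  entropy_smul : ∀ c : ℝ, 0 < c → ∃ s : ℝ, 0 < s ∧ ∀ (X : Type u) [Fintype X] (p v : X → ℝ),
    ∑ x, p x = 1 → 0 < ∑ x, p x * v x →
    ∑ x, p x * φ (c * v x) - φ (∑ x, p x * (c * v x))
      = s * (∑ x, p x * φ (v x) - φ (∑ x, p x * v x))
  entropy_average_le : ∀ (X : Type u) [Fintype X] (ι : Type) (p : X → ℝ) (s : Finset ι)
    (v : ι → X → ℝ), p ∈ stdSimplex ℝ X → s.Nonempty → (∀ i x, 0 ≤ v i x) →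
    ∑ x, p x * φ ((∑ i ∈ s, v i x) / s.card) - φ ((∑ i ∈ s, ∑ x, p x * v i x) / s.card)
      ≤ (∑ i ∈ s, (∑ x, p x * φ (v i x) - φ (∑ x, p x * v i x))) / s.card
  pair_le : ∀ (ι : Type) [DecidableEq ι] (s : Finset ι) (m : ℕ) (w : ι → ι → ℝ) (h : ι → ℝ)
    (c : ℝ), s.card = m + 2 → (∀ y z, 0 ≤ w y z) → (∀ y z, w y z = w z y) →
    (∀ y ∈ s, h y = (∑ z ∈ s.erase y, w y z) / (m + 1)) → c = (∑ y ∈ s, h y) / (m + 2) →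
    2 * γ (m + 1) * ((∑ y ∈ s, φ (h y)) / (m + 2)) ≤
      γ m * ((∑ y ∈ s, (∑ z ∈ s.erase y, φ (w y z)) / (m + 1)) / (m + 2)) + γ (m + 2) * φ c

theorem entropyFunction_klFun : EntropyFunction.{u} klFun fun _ => 1 where
  convexOn := convexOn_klFun
  map_one := by simp [klFun]
  entropy_smul c hc := ⟨c, hc, fun _ _ _ _ _ hv => klFun_entropy_smul hc hv⟩
  entropy_average_le _ _ _ _ s v hp hs hv := klFun_entropy_average_le hp s hs v hv
  pair_le _ _ _ _ _ _ _ hs hw hsymm hh hc := by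
    simpa using klFun_pair_le hs hw hsymm hh hc

theorem entropyFunction_chiSqFun : EntropyFunction.{u} chiSqFun fun r => r where
  convexOn := convexOn_chiSqFun
  map_one := by simp [chiSqFun]
  entropy_smul c hc := ⟨c ^ 2, by positivity, fun _ _ _ v hp _ => chiSqFun_entropy_smul c hp v⟩
  entropy_average_le _ _ _ _ s v hp hs _ := chiSqFun_entropy_average_le hp s hs v
  pair_le _ _ _ _ _ _ _ hs _ hsymm hh hc := by
    simpa using chiSqFun_pair_le hs hsymm hh hc

/-! ### Entropy contraction on the Johnson scheme -/

section Johnson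

variable {n : ℕ}

/-- The average of `f` over all `k`-element subsets of `Fin n`. -/
noncomputable def levelAvg (k : ℕ) (f : Finset (Fin n) → ℝ) : ℝ :=
  (∑ S ∈ Finset.powersetCard k Finset.univ, f S) / (n.choose k : ℝ)

/-- The average of `f` over all sets obtained from `T` by adding one element. -/
noncomputable def upAvg (f : Finset (Fin n) → ℝ) (T : Finset (Fin n)) : ℝ :=
  (∑ i ∈ Tᶜ, f (insert i T)) / (Tᶜ.card : ℝ)

theorem sum_powersetCard_succ_erase (j : ℕ) (G : Fin n → Finset (Fin n) → ℝ) :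
    ∑ S ∈ Finset.powersetCard (j + 1) Finset.univ, ∑ i ∈ S, G i (S.erase i)
      = ∑ T ∈ Finset.powersetCard j Finset.univ, ∑ i ∈ Tᶜ, G i T := by
  rw [Finset.sum_sigma', Finset.sum_sigma']
  refine Finset.sum_bij' (fun a _ => ⟨a.1.erase a.2, a.2⟩) (fun a _ => ⟨insert a.2 a.1, a.2⟩)
    ?_ ?_ ?_ ?_ ?_
  · rintro ⟨S, i⟩ h
    simp only [Finset.mem_sigma, Finset.mem_powersetCard_univ, Finset.mem_compl,
      Finset.mem_erase] at h ⊢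
    rw [Finset.card_erase_of_mem h.2, h.1]
    simp
  · rintro ⟨T, i⟩ h
    simp only [Finset.mem_sigma, Finset.mem_powersetCard_univ, Finset.mem_compl] at h ⊢
    rw [Finset.card_insert_of_notMem h.2, h.1]
    simp
  · rintro ⟨S, i⟩ h
    simp only [Finset.mem_sigma] at h
    simp [Finset.insert_erase h.2]
  · rintro ⟨T, i⟩ h
    simp only [Finset.mem_sigma, Finset.mem_compl] at h
    simp [Finset.erase_insert h.2]
  · rintro ⟨S, i⟩ _
    rfl

theorem card_compl_cast {j : ℕ} {T : Finset (Fin n)}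
    (hT : T ∈ Finset.powersetCard j Finset.univ) : (Tᶜ.card : ℝ) = ((n - j : ℕ) : ℝ) := by
  rw [Finset.card_compl, Finset.mem_powersetCard_univ.1 hT, Fintype.card_fin]

theorem choose_succ_mul (n j : ℕ) :
    (n.choose (j + 1) : ℝ) * (j + 1) = n.choose j * ((n - j : ℕ) : ℝ) := by
  exact_mod_cast Nat.choose_succ_right_eq n j

/-- Double counting of the pairs `(T, insert i T)` with `T` of cardinality `j`. -/
theorem levelAvg_succ_erase {j : ℕ} (hj : j < n) (G : Fin n → Finset (Fin n) → ℝ) :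
    levelAvg (j + 1) (fun S => (∑ i ∈ S, G i (S.erase i)) / (j + 1))
      = levelAvg j fun T => (∑ i ∈ Tᶜ, G i T) / (Tᶜ.card : ℝ) := by
  have h1 : (n.choose (j + 1) : ℝ) ≠ 0 := by exact_mod_cast (Nat.choose_pos hj).ne'
  have h2 : (n.choose j : ℝ) ≠ 0 := by exact_mod_cast (Nat.choose_pos hj.le).ne'
  have h3 : ((n - j : ℕ) : ℝ) ≠ 0 := by exact_mod_cast (Nat.sub_pos_of_lt hj).ne'
  have e : ∑ T ∈ Finset.powersetCard j (Finset.univ : Finset (Fin n)),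
      (∑ i ∈ Tᶜ, G i T) / (Tᶜ.card : ℝ)
      = (∑ T ∈ Finset.powersetCard j Finset.univ, ∑ i ∈ Tᶜ, G i T) / ((n - j : ℕ) : ℝ) := by
    rw [Finset.sum_div]
    exact Finset.sum_congr rfl fun T hT => by rw [card_compl_cast hT]
  rw [levelAvg, levelAvg, e, ← Finset.sum_div, sum_powersetCard_succ_erase, div_div, div_div,
    mul_comm _ (n.choose j : ℝ), ← choose_succ_mul, mul_comm]

theorem levelAvg_upAvg {j : ℕ} (hj : j < n) (f : Finset (Fin n) → ℝ) :
    levelAvg j (upAvg f) = levelAvg (j + 1) f := by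
  unfold upAvg
  rw [← levelAvg_succ_erase hj fun i T => f (insert i T)]
  unfold levelAvg
  congr 1
  refine Finset.sum_congr rfl fun S hS => ?_
  have e : ∑ i ∈ S, f (insert i (S.erase i)) = ∑ _i ∈ S, f S :=
    Finset.sum_congr rfl fun i hi => by rw [Finset.insert_erase hi]
  simp only [e, Finset.sum_const, Finset.mem_powersetCard_univ.1 hS]
  have : (j + 1 : ℝ) ≠ 0 := by positivity
  push_cast [nsmul_eq_mul]
  field_simp

theorem levelAvg_mono {k : ℕ} {f g : Finset (Fin n) → ℝ} (h : ∀ S, S.card = k → f S ≤ g S) :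
    levelAvg k f ≤ levelAvg k g :=
  div_le_div_of_nonneg_right (Finset.sum_le_sum fun S hS =>
    h S (Finset.mem_powersetCard_univ.1 hS)) (Nat.cast_nonneg _)

theorem levelAvg_congr {k : ℕ} {f g : Finset (Fin n) → ℝ} (h : ∀ S, S.card = k → f S = g S) :
    levelAvg k f = levelAvg k g :=
  le_antisymm (levelAvg_mono fun S hS => (h S hS).le) (levelAvg_mono fun S hS => (h S hS).ge)

theorem levelAvg_add (k : ℕ) (f g : Finset (Fin n) → ℝ) :
    levelAvg k (fun S => f S + g S) = levelAvg k f + levelAvg k g := by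
  simp only [levelAvg, Finset.sum_add_distrib, add_div]

theorem levelAvg_sub (k : ℕ) (f g : Finset (Fin n) → ℝ) :
    levelAvg k (fun S => f S - g S) = levelAvg k f - levelAvg k g := by
  simp only [levelAvg, Finset.sum_sub_distrib, sub_div]

theorem levelAvg_const_mul (k : ℕ) (c : ℝ) (f : Finset (Fin n) → ℝ) :
    levelAvg k (fun S => c * f S) = c * levelAvg k f := by
  simp only [levelAvg, ← Finset.mul_sum, mul_div_assoc]

theorem levelAvg_zero (f : Finset (Fin n) → ℝ) : levelAvg 0 f = f ∅ := by
  simp [levelAvg]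

theorem upAvg_nonneg {f : Finset (Fin n) → ℝ} (hf : ∀ S, 0 ≤ f S) (T : Finset (Fin n)) :
    0 ≤ upAvg f T :=
  div_nonneg (Finset.sum_nonneg fun _ _ => hf _) (Nat.cast_nonneg _)

variable {φ : ℝ → ℝ} {γ : ℕ → ℝ}

/-- The pair inequality in the link of a set `R` of cardinality `r`. -/
theorem EntropyFunction.upAvg_le (hφ : EntropyFunction φ γ) {h : Finset (Fin n) → ℝ}
    (hh : ∀ S, 0 ≤ h S) {r : ℕ} (hr : r + 2 ≤ n) {R : Finset (Fin n)} (hR : R.card = r) :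
    2 * γ (n - (r + 1)) * upAvg (fun T => φ (upAvg h T)) R
      ≤ γ (n - (r + 2)) * upAvg (upAvg fun S => φ (h S)) R
        + γ (n - r) * φ (upAvg (upAvg h) R) := by
  obtain ⟨m, rfl⟩ : ∃ m, n = r + 2 + m := ⟨n - (r + 2), by omega⟩
  have hcard : Rᶜ.card = m + 2 := by
    rw [Finset.card_compl, hR, Fintype.card_fin]; omega
  have hcompl : ∀ y, (insert y R)ᶜ = Rᶜ.erase y := fun y => Finset.compl_insert
  have hcard' : ∀ y ∈ Rᶜ, ((Rᶜ.erase y).card : ℝ) = m + 1 := by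
    intro y hy
    rw [Finset.card_erase_of_mem hy, hcard]
    push_cast [Nat.add_succ_sub_one]
    rfl
  have hc2 : ((Rᶜ.card : ℕ) : ℝ) = m + 2 := by rw [hcard]; push_cast; rfl
  have key := hφ.pair_le (Fin (r + 2 + m)) Rᶜ m (fun y z => h (insert z (insert y R)))
    (fun y => upAvg h (insert y R)) (upAvg (upAvg h) R) hcard (fun _ _ => hh _)
    (fun y z => by rw [Finset.insert_comm])
    (fun y hy => by rw [upAvg, hcompl, hcard' y hy]) (by rw [upAvg, hc2])
  have e1 : r + 2 + m - (r + 1) = m + 1 := by omega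
  have e2 : r + 2 + m - (r + 2) = m := by omega
  have e3 : r + 2 + m - r = m + 2 := by omega
  rw [e1, e2, e3]
  have e4 : upAvg (fun T => φ (upAvg h T)) R
      = (∑ y ∈ Rᶜ, φ (upAvg h (insert y R))) / (m + 2) := by rw [upAvg, hc2]
  have e5 : upAvg (upAvg fun S => φ (h S)) R
      = (∑ y ∈ Rᶜ, (∑ z ∈ Rᶜ.erase y, φ (h (insert z (insert y R)))) / (m + 1)) / (m + 2) := by
    rw [upAvg, hc2]
    congr 1
    refine Finset.sum_congr rfl fun y hy => ?_
    rw [upAvg, hcompl, hcard' y hy]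
  rw [e4, e5]
  exact key

/-- Entropy contraction of the down operator on the Johnson scheme. -/
theorem EntropyFunction.levelAvg_upAvg_le (hφ : EntropyFunction φ γ) {j : ℕ} (hj : j < n)
    {h : Finset (Fin n) → ℝ} (hh : ∀ S, 0 ≤ h S) (h1 : levelAvg (j + 1) h = 1) :
    γ (n - j) * (j + 1) * levelAvg j (fun T => φ (upAvg h T))
      ≤ j * γ (n - (j + 1)) * levelAvg (j + 1) fun S => φ (h S) := by
  induction j generalizing h with
  | zero =>
    -- At level 0 the only set is empty and its density is 1, so both sides vanish.
    rw [levelAvg_zero]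
    rw [← levelAvg_upAvg hj, levelAvg_zero] at h1
    rw [h1, hφ.map_one]
    simp
  | succ r ih =>
    have hr : r < n := by omega
    have ih' := ih hr (upAvg_nonneg hh) ((levelAvg_upAvg hj h).trans h1)
    have hloc := levelAvg_mono fun R hR => hφ.upAvg_le hh hj hR
    rw [levelAvg_add, levelAvg_const_mul, levelAvg_const_mul, levelAvg_const_mul,
      levelAvg_upAvg hr, levelAvg_upAvg hr, levelAvg_upAvg hj] at hloc
    push_cast at ih' ⊢
    have hr1 : (0 : ℝ) < r + 1 := by positivity
    -- The factor r + 1 matches the level-r term of the local inequality with the induction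
    -- hypothesis; one of the 2(r + 1) copies is not absorbed beyond r, leaving coefficient r + 2.
    have := mul_le_mul_of_nonneg_left hloc hr1.le
    linarith

end Johnson

/-! ### Down and up operators -/

section Down

theorem sum_slice {Ω : Type*} [Fintype Ω] (k : ℕ) (f : Finset Ω → ℝ) :
    ∑ A : Slice Ω k, f A.1 = ∑ A ∈ Finset.powersetCard k Finset.univ, f A :=
  (Finset.sum_subtype _ (fun _ => Finset.mem_powersetCard_univ) f).symm

variable {Ω : Type*} [DecidableEq Ω]

theorem sum_powersetCard_superset {R T : Finset Ω} (hTR : T ⊆ R) {j : ℕ} (hT : T.card = j)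
    (f : Finset Ω → ℝ) :
    (∑ A ∈ R.powersetCard (j + 1), if T ⊆ A then f A else 0) = ∑ i ∈ R \ T, f (insert i T) := by
  rw [← Finset.sum_filter]
  symm
  refine Finset.sum_bij (fun i _ => insert i T) ?_ ?_ ?_ ?_
  · intro i hi
    rw [Finset.mem_sdiff] at hi
    rw [Finset.mem_filter, Finset.mem_powersetCard, Finset.card_insert_of_notMem hi.2, hT]
    exact ⟨⟨Finset.insert_subset hi.1 hTR, rfl⟩, Finset.subset_insert i T⟩
  · intro i hi i' hi' h
    exact (Finset.insert_inj (Finset.mem_sdiff.1 hi).2).1 h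
  · intro A hA
    rw [Finset.mem_filter, Finset.mem_powersetCard] at hA
    obtain ⟨⟨hAR, hA⟩, hTA⟩ := hA
    obtain ⟨i, hi⟩ := Finset.card_eq_one.1
      (show (A \ T).card = 1 by rw [Finset.card_sdiff_of_subset hTA, hA, hT]; omega)
    have hi' : i ∈ A \ T := hi ▸ Finset.mem_singleton_self i
    rw [Finset.mem_sdiff] at hi'
    refine ⟨i, Finset.mem_sdiff.2 ⟨hAR hi'.1, hi'.2⟩, ?_⟩
    rw [Finset.insert_eq, ← hi, Finset.sdiff_union_of_subset hTA]
  · intro i _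
    rfl

theorem down_nonneg (k ℓ : ℕ) (A : Slice Ω k) (B : Slice Ω ℓ) : 0 ≤ down Ω k ℓ A B := by
  unfold down
  split_ifs
  · positivity
  · rfl

theorem down_self (k : ℕ) : down Ω k k = 1 := by
  ext A B
  rw [down, Matrix.one_apply, Nat.choose_self]
  have : B.1 ⊆ A.1 ↔ A = B := by
    constructor
    · intro h
      exact Subtype.ext (Finset.eq_of_subset_of_card_le h (by rw [A.2, B.2])).symm
    · rintro rfl
      exact subset_rfl
  simp [this]

variable [Fintype Ω]

theorem sum_slice_subset (k : ℕ) (R : Finset Ω) (f : Finset Ω → ℝ) :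
    (∑ A : Slice Ω k, if A.1 ⊆ R then f A.1 else 0) = ∑ A ∈ R.powersetCard k, f A := by
  rw [sum_slice k fun A => if A ⊆ R then f A else 0, ← Finset.sum_filter]
  refine Finset.sum_congr ?_ fun _ _ => rfl
  ext A
  simp only [Finset.mem_filter, Finset.mem_powersetCard, Finset.subset_univ, true_and]
  tauto

theorem sum_down {k ℓ : ℕ} (h : ℓ ≤ k) (A : Slice Ω k) : ∑ B, down Ω k ℓ A B = 1 := by
  unfold down
  rw [sum_slice_subset ℓ A.1 fun _ => 1 / (k.choose ℓ : ℝ), Finset.sum_const,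
    Finset.card_powersetCard, A.2, nsmul_eq_mul]
  have : (k.choose ℓ : ℝ) ≠ 0 := by exact_mod_cast (Nat.choose_pos h).ne'
  field_simp

/-- There are k - ℓ intermediate sets, all with the same weight, and this number turns one binomial
coefficient into the other. -/
theorem down_mul_down {k ℓ : ℕ} (h : ℓ < k) :
    down Ω k (ℓ + 1) * down Ω (ℓ + 1) ℓ = down Ω k ℓ := by
  ext A B
  have h1 : (k.choose (ℓ + 1) : ℝ) ≠ 0 := by exact_mod_cast (Nat.choose_pos h).ne'
  have h2 : (k.choose ℓ : ℝ) ≠ 0 := by exact_mod_cast (Nat.choose_pos h.le).ne'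
  have e : (down Ω k (ℓ + 1) * down Ω (ℓ + 1) ℓ) A B
      = ∑ D ∈ A.1.powersetCard (ℓ + 1),
        if B.1 ⊆ D then 1 / ((k.choose (ℓ + 1) : ℝ) * (ℓ + 1)) else 0 := by
    rw [← sum_slice_subset, Matrix.mul_apply]
    refine Finset.sum_congr rfl fun D _ => ?_
    unfold down
    rw [Nat.choose_succ_self_right]
    split_ifs
    · push_cast
      rw [div_mul_div_comm, one_mul]
    all_goals simp
  rw [e]
  unfold down
  split_ifs with hBA
  · rw [sum_powersetCard_superset hBA B.2, Finset.sum_const, Finset.card_sdiff_of_subset hBA,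
      A.2, B.2, nsmul_eq_mul, choose_succ_mul]
    have h3 : ((k - ℓ : ℕ) : ℝ) ≠ 0 := by exact_mod_cast (Nat.sub_pos_of_lt h).ne'
    field_simp
  · refine Finset.sum_eq_zero fun D hD => if_neg fun hBD => hBA ?_
    exact hBD.trans (Finset.mem_powersetCard.1 hD).1

theorem sum_up {k ℓ : ℕ} {μ : Slice Ω k → ℝ} {B : Slice Ω ℓ}
    (hB : (μ ᵥ* down Ω k ℓ) B ≠ 0) : ∑ A, up ℓ μ B A = 1 := by
  have e : (μ ᵥ* down Ω k ℓ) B = (∑ A : Slice Ω k with B.1 ⊆ A.1, μ A) * (1 / (k.choose ℓ : ℝ)) := by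
    rw [Finset.sum_mul, Finset.sum_filter]
    refine Finset.sum_congr rfl fun A _ => ?_
    simp [down]
  have h0 : ∑ A : Slice Ω k with B.1 ⊆ A.1, μ A ≠ 0 := fun h => hB (by rw [e, h, zero_mul])
  unfold up
  rw [← Finset.sum_filter, ← Finset.sum_div, div_self h0]

theorem up_nonneg {k : ℕ} (ℓ : ℕ) {μ : Slice Ω k → ℝ} (hμ : ∀ A, 0 ≤ μ A) (B : Slice Ω ℓ)
    (A : Slice Ω k) : 0 ≤ up ℓ μ B A := by
  unfold up
  split_ifs
  · exact div_nonneg (hμ A) (Finset.sum_nonneg fun A' _ => hμ A')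
  · rfl

/-- Contraction of the down operator implies contraction of the down-up walk. -/
theorem Contracts.downUpWalk {f : ℝ → ℝ} (hf : ConvexOn ℝ (Set.Ici 0) f) {k ℓ : ℕ} {ρ : ℝ}
    {μ : Slice Ω k → ℝ} (hμ : ∀ A, 0 ≤ μ A) (h : Contracts f (down Ω k ℓ) ρ μ) :
    Contracts f (downUpWalk ℓ μ) ρ μ := by
  intro ν hν hνμ
  refine le_trans ?_ (h ν hν hνμ)
  rw [DownUp.downUpWalk, ← Matrix.vecMul_vecMul, ← Matrix.vecMul_vecMul]
  -- The rows of `up` need to sum to one only where the pushed-down law is nonzero.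
  exact fDiv_vecMul_le hf (vecMul_nonneg hμ (down_nonneg k ℓ))
    (vecMul_nonneg hν.1 (down_nonneg k ℓ)) (up_nonneg ℓ hμ) (fun B hB => sum_up hB)
    (vecMul_eq_zero_of_eq_zero hμ (down_nonneg k ℓ) hνμ)

end Down

/-! ### Homogenization: levels as restrictions to random coordinate sets -/

section Homogenization

variable {n : ℕ} {Ω' : Fin n → Type*}

/-- The restriction of `σ` to the coordinates in `S`, as a set of pairs. -/
def restrict (S : Finset (Fin n)) (σ : ∀ i, Ω' i) : Finset (Σ i, Ω' i) :=
  S.map ⟨fun i => ⟨i, σ i⟩, fun _ _ h => congrArg Sigma.fst h⟩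

@[simp]
theorem card_restrict (S : Finset (Fin n)) (σ : ∀ i, Ω' i) : (restrict S σ).card = S.card :=
  Finset.card_map _

theorem mem_restrict {S : Finset (Fin n)} {σ : ∀ i, Ω' i} {a : Σ i, Ω' i} :
    a ∈ restrict S σ ↔ a.1 ∈ S ∧ σ a.1 = a.2 := by
  rcases a with ⟨i, a⟩
  simp only [restrict, Finset.mem_map]
  constructor
  · rintro ⟨j, hj, h⟩
    obtain ⟨rfl, h⟩ := Sigma.mk.inj_iff.1 h
    exact ⟨hj, eq_of_heq h⟩
  · rintro ⟨hi, rfl⟩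
    exact ⟨i, hi, rfl⟩

/-- Elements carry their coordinate as a tag, so a restriction determines its coordinate set, and
containment becomes agreement on T. -/
theorem restrict_subset_iff {S T : Finset (Fin n)} {σ τ : ∀ i, Ω' i} :
    restrict T τ ⊆ restrict S σ ↔ T ⊆ S ∧ restrict T σ = restrict T τ := by
  constructor
  · intro h
    have h' : ∀ i ∈ T, i ∈ S ∧ σ i = τ i := fun i hi =>
      mem_restrict.1 (h (mem_restrict.2 (⟨hi, rfl⟩ : (⟨i, τ i⟩ : Σ i, Ω' i).1 ∈ T ∧ _)))
    refine ⟨fun i hi => (h' i hi).1, ?_⟩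
    ext ⟨i, a⟩
    simp only [mem_restrict]
    exact and_congr_right fun hi => by rw [(h' i hi).2]
  · rintro ⟨h, e⟩
    rw [← e]
    exact Finset.map_subset_map.2 h

theorem filter_restrict {S T : Finset (Fin n)} (h : T ⊆ S) (σ : ∀ i, Ω' i) :
    (restrict S σ).filter (fun a => a.1 ∈ T) = restrict T σ := by
  ext a
  simp only [Finset.mem_filter, mem_restrict]
  exact ⟨fun ⟨⟨_, h2⟩, h3⟩ => ⟨h3, h2⟩, fun ⟨h1, h2⟩ => ⟨⟨h h1, h2⟩, h1⟩⟩

variable [∀ i, Fintype (Ω' i)] [∀ i, DecidableEq (Ω' i)] {μ : (∀ i, Ω' i) → ℝ}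

theorem sum_homogenization (F : Slice (Σ i, Ω' i) n → ℝ) :
    ∑ A, homogenization μ A * F A = ∑ σ, μ σ * F (toSlice σ) := by
  simp_rw [homogenization, Finset.sum_mul, Finset.sum_filter]
  rw [Finset.sum_comm]
  refine Finset.sum_congr rfl fun σ _ => ?_
  simp

theorem homLevel_self : homLevel μ n = homogenization μ := by
  rw [homLevel, down_self, Matrix.vecMul_one]

theorem homLevel_mem_stdSimplex (hμ : μ ∈ stdSimplex ℝ (∀ i, Ω' i)) {k : ℕ} (hk : k ≤ n) :
    homLevel μ k ∈ stdSimplex ℝ (Slice (Σ i, Ω' i) k) := by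
  refine vecMul_mem_stdSimplex ⟨fun A => Finset.sum_nonneg fun σ _ => hμ.1 σ, ?_⟩
    (down_nonneg n k) (sum_down hk)
  simpa [hμ.2] using sum_homogenization (μ := μ) fun _ => 1

theorem homLevel_vecMul_down {j : ℕ} (hj : j < n) :
    homLevel μ (j + 1) ᵥ* down (Σ i, Ω' i) (j + 1) j = homLevel μ j := by
  rw [homLevel, Matrix.vecMul_vecMul, down_mul_down hj, homLevel]

/-- A `μ_k`-random set is the restriction of a `μ`-random point to a uniformly random set of `k`
coordinates. -/
theorem sum_homLevel (k : ℕ) (F : Finset (Σ i, Ω' i) → ℝ) :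
    ∑ A : Slice (Σ i, Ω' i) k, homLevel μ k A * F A.1
      = levelAvg k fun S => ∑ σ, μ σ * F (restrict S σ) := by
  have e1 : ∀ B : Slice (Σ i, Ω' i) n, ∑ A : Slice (Σ i, Ω' i) k, down (Σ i, Ω' i) n k B A * F A.1
      = (∑ A ∈ B.1.powersetCard k, F A) / (n.choose k : ℝ) := by
    intro B
    rw [Finset.sum_div, ← sum_slice_subset]
    refine Finset.sum_congr rfl fun A _ => ?_
    rw [down, ite_mul, zero_mul, one_div_mul_eq_div]
  have e2 : ∑ A : Slice (Σ i, Ω' i) k, homLevel μ k A * F A.1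
      = ∑ B, homogenization μ B * ((∑ A ∈ B.1.powersetCard k, F A) / (n.choose k : ℝ)) := by
    simp_rw [← e1, homLevel, Matrix.vecMul, dotProduct, Finset.sum_mul, Finset.mul_sum]
    rw [Finset.sum_comm]
    simp_rw [mul_assoc]
  rw [e2, sum_homogenization, levelAvg, Finset.sum_comm, Finset.sum_div]
  refine Finset.sum_congr rfl fun σ _ => ?_
  rw [← Finset.mul_sum, mul_div_assoc]
  congr 2
  exact (congrArg (fun s => ∑ A ∈ s, F A) (Finset.powersetCard_map _ k Finset.univ)).trans
    (Finset.sum_map _ _ _)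

theorem homLevel_restrict {j : ℕ} {T : Finset (Fin n)} (hT : T.card = j) (τ : ∀ i, Ω' i) :
    homLevel μ j ⟨restrict T τ, by rw [card_restrict, hT]⟩
      = (∑ σ with restrict T σ = restrict T τ, μ σ) / (n.choose j : ℝ) := by
  have h := sum_homLevel (μ := μ) j fun A => if A = restrict T τ then 1 else 0
  rw [Finset.sum_eq_single ⟨restrict T τ, by rw [card_restrict, hT]⟩] at h
  · rw [if_pos rfl, mul_one] at h
    rw [h, levelAvg, Finset.sum_eq_single T]
    · simp [Finset.sum_filter]
    · intro S hS hST
      refine Finset.sum_eq_zero fun σ _ => ?_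
      rw [if_neg, mul_zero]
      intro e
      refine hST (Finset.eq_of_subset_of_card_le (restrict_subset_iff.1 e.subset).1 ?_)
      rw [hT, Finset.mem_powersetCard_univ.1 hS]
    · intro h
      exact absurd (Finset.mem_powersetCard_univ.2 hT) h
  · intro A _ hA
    rw [if_neg fun e => hA (Subtype.ext e), mul_zero]
  · intro h
    exact absurd (Finset.mem_univ _) h

theorem vecMul_down_restrict {j : ℕ} (g : Finset (Σ i, Ω' i) → ℝ) {T : Finset (Fin n)}
    (hT : T.card = j) (τ : ∀ i, Ω' i) :
    ((fun A : Slice (Σ i, Ω' i) (j + 1) => homLevel μ (j + 1) A * g A.1)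
        ᵥ* down (Σ i, Ω' i) (j + 1) j) ⟨restrict T τ, by rw [card_restrict, hT]⟩
      = (∑ i ∈ Tᶜ, ∑ σ with restrict T σ = restrict T τ, μ σ * g (restrict (insert i T) σ))
        / ((n.choose (j + 1) : ℝ) * (j + 1)) := by
  have e : ((fun A : Slice (Σ i, Ω' i) (j + 1) => homLevel μ (j + 1) A * g A.1)
        ᵥ* down (Σ i, Ω' i) (j + 1) j) ⟨restrict T τ, by rw [card_restrict, hT]⟩
      = ∑ A : Slice (Σ i, Ω' i) (j + 1), homLevel μ (j + 1) A *
        (fun A => if restrict T τ ⊆ A then g A / (j + 1 : ℝ) else 0) A.1 := by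
    refine Finset.sum_congr rfl fun A _ => ?_
    simp only [down, Nat.choose_succ_self_right]
    split_ifs
    · push_cast; ring
    · simp
  rw [e, sum_homLevel (j + 1) fun A => if restrict T τ ⊆ A then g A / (j + 1 : ℝ) else 0,
    levelAvg, mul_comm, ← div_div]
  congr 1
  have e2 : ∀ S : Finset (Fin n),
      (∑ σ, μ σ * if restrict T τ ⊆ restrict S σ then g (restrict S σ) / (j + 1 : ℝ) else 0)
      = if T ⊆ S then (∑ σ with restrict T σ = restrict T τ, μ σ * g (restrict S σ)) / (j + 1 : ℝ)
        else 0 := by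
    intro S
    simp_rw [restrict_subset_iff]
    by_cases hTS : T ⊆ S
    · simp only [hTS, true_and, if_true]
      rw [Finset.sum_div, Finset.sum_filter]
      refine Finset.sum_congr rfl fun σ _ => ?_
      rw [mul_ite, mul_zero, mul_div_assoc]
    · simp [hTS]
  simp_rw [e2]
  rw [sum_powersetCard_superset (Finset.subset_univ T) hT, Finset.sum_div,
    Finset.compl_eq_univ_sdiff]

/-- Going down reveals neither the removed coordinate, uniform outside T, nor its value; the new
density averages over the first and takes a conditional mean over the second. -/
theorem density_restrict {j : ℕ} (hj : j < n) (g : Finset (Σ i, Ω' i) → ℝ) {T : Finset (Fin n)}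
    (hT : T.card = j) (τ : ∀ i, Ω' i) :
    ((fun A : Slice (Σ i, Ω' i) (j + 1) => homLevel μ (j + 1) A * g A.1)
        ᵥ* down (Σ i, Ω' i) (j + 1) j) ⟨restrict T τ, by rw [card_restrict, hT]⟩
      / homLevel μ j ⟨restrict T τ, by rw [card_restrict, hT]⟩
      = (∑ i ∈ Tᶜ, condMean μ (restrict T) (fun σ => g (restrict (insert i T) σ)) τ)
        / (Tᶜ.card : ℝ) := by
  have h2 : (n.choose j : ℝ) ≠ 0 := by exact_mod_cast (Nat.choose_pos hj.le).ne'
  rw [vecMul_down_restrict g hT, homLevel_restrict hT, choose_succ_mul,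
    card_compl_cast (Finset.mem_powersetCard_univ.2 hT)]
  unfold condMean
  -- Only the binomial coefficient is cancelled: z may be the mass of a null fiber.
  have e : ∀ a z d : ℝ, a / (n.choose j * d) / (z / n.choose j) = a / z / d := by
    intro a z d
    have h3 := inv_mul_cancel₀ h2
    simp only [div_eq_mul_inv, mul_inv, inv_inv]
    linear_combination a * d⁻¹ * z⁻¹ * h3
  rw [← Finset.sum_div, e]

theorem fDiv_homLevel (f : ℝ → ℝ) (k : ℕ) (g : Finset (Σ i, Ω' i) → ℝ) :
    fDiv f (fun A : Slice (Σ i, Ω' i) k => homLevel μ k A * g A.1) (homLevel μ k)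
      = levelAvg k fun S => ∑ σ, μ σ * f (g (restrict S σ)) := by
  rw [← sum_homLevel k fun A => f (g A)]
  refine Finset.sum_congr rfl fun A _ => ?_
  by_cases h : homLevel μ k A = 0
  · simp [h]
  · rw [mul_div_cancel_left₀ _ h]

theorem fDiv_vecMul_down (f : ℝ → ℝ) {j : ℕ} (hj : j < n) (g : Finset (Σ i, Ω' i) → ℝ) :
    fDiv f ((fun A : Slice (Σ i, Ω' i) (j + 1) => homLevel μ (j + 1) A * g A.1)
        ᵥ* down (Σ i, Ω' i) (j + 1) j) (homLevel μ (j + 1) ᵥ* down (Σ i, Ω' i) (j + 1) j)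
      = levelAvg j fun T => ∑ σ, μ σ * f ((∑ i ∈ Tᶜ,
        condMean μ (restrict T) (fun σ => g (restrict (insert i T) σ)) σ) / (Tᶜ.card : ℝ)) := by
  rw [homLevel_vecMul_down hj]
  set ν := (fun A : Slice (Σ i, Ω' i) (j + 1) => homLevel μ (j + 1) A * g A.1)
        ᵥ* down (Σ i, Ω' i) (j + 1) j with hν
  let F : Finset (Σ i, Ω' i) → ℝ := fun B =>
    if h : B.card = j then f (ν ⟨B, h⟩ / homLevel μ j ⟨B, h⟩) else 0
  have e : fDiv f ν (homLevel μ j) = ∑ B : Slice (Σ i, Ω' i) j, homLevel μ j B * F B.1 := by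
    refine Finset.sum_congr rfl fun B _ => ?_
    simp only [F, dif_pos B.2]
  rw [e, sum_homLevel]
  refine levelAvg_congr fun T hT => Finset.sum_congr rfl fun σ _ => ?_
  rw [← density_restrict hj g hT]
  simp only [F]
  rw [dif_pos (by rw [card_restrict, hT])]

end Homogenization

/-! ### From tensorization to contraction at every level -/

section Tensorization

variable {φ : ℝ → ℝ} {γ : ℕ → ℝ}

theorem levelAvg_self {n : ℕ} (f : Finset (Fin n) → ℝ) : levelAvg n f = f Finset.univ := by
  have : Finset.powersetCard n (Finset.univ : Finset (Fin n)) = {Finset.univ} := by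
    simpa using Finset.powersetCard_self (Finset.univ : Finset (Fin n))
  simp [levelAvg, this]

/-- Approximate tensorization of the `φ`-entropy for functions of the whole configuration. -/
theorem Contracts.entropy_le {n : ℕ} (hn : 1 ≤ n) {Ω' : Fin n → Type u} [∀ i, Fintype (Ω' i)]
    [∀ i, DecidableEq (Ω' i)] {μ : (∀ i, Ω' i) → ℝ} (hμ : μ ∈ stdSimplex ℝ (∀ i, Ω' i))
    {C : ℝ} (hC : 0 < C) (hφ : EntropyFunction.{u} φ γ)
    (h : Contracts φ (down (Σ i, Ω' i) n (n - 1)) (1 - 1 / (C * n)) (homogenization μ))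
    {g : Finset (Σ i, Ω' i) → ℝ} (hg : ∀ A, 0 ≤ g A) :
    ∑ σ, μ σ * φ (g (restrict Finset.univ σ)) - φ (∑ σ, μ σ * g (restrict Finset.univ σ))
      ≤ C * ∑ i, (∑ σ, μ σ * φ (g (restrict Finset.univ σ))
        - ∑ σ, μ σ * φ (condMean μ (restrict (Finset.univ.erase i))
          (fun σ => g (restrict Finset.univ σ)) σ)) := by
  obtain ⟨N, rfl⟩ : ∃ N, n = N + 1 := ⟨n - 1, by omega⟩
  have hlevel := homLevel_mem_stdSimplex hμ le_rfl
  -- the inequality for densities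
  have normalized : ∀ g : Finset (Σ i, Ω' i) → ℝ, (∀ A, 0 ≤ g A) →
      ∑ σ, μ σ * g (restrict Finset.univ σ) = 1 →
      ∑ σ, μ σ * φ (g (restrict Finset.univ σ)) ≤ C * ∑ i, (∑ σ, μ σ * φ (g (restrict Finset.univ σ))
        - ∑ σ, μ σ * φ (condMean μ (restrict (Finset.univ.erase i))
          (fun σ => g (restrict Finset.univ σ)) σ)) := by
    intro g hg hg1
    rw [← homLevel_self] at h
    have h' := h (fun A => homLevel μ (N + 1) A * g A.1)
      ⟨fun A => mul_nonneg (hlevel.1 A) (hg _), by rw [sum_homLevel, levelAvg_self, hg1]⟩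
      (fun A hA => by rw [hA, zero_mul])
    rw [fDiv_homLevel, levelAvg_self] at h'
    have e := fDiv_vecMul_down (μ := μ) φ (Nat.lt_succ_self N) g
    set f : Finset (Fin (N + 1)) → ℝ := fun T => ∑ σ, μ σ * φ (condMean μ (restrict T)
          (fun σ => g (restrict Finset.univ σ)) σ) with hf
    -- At level N the complement of T is one coordinate, so the inner average has a single term.
    have e2 : (levelAvg N fun T => ∑ σ, μ σ * φ ((∑ i ∈ Tᶜ,
        condMean μ (restrict T) (fun σ => g (restrict (insert i T) σ)) σ) / (Tᶜ.card : ℝ)))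
        = (∑ i, f (Finset.univ.erase i)) / (N + 1) := by
      rw [← levelAvg_self fun S => (∑ i ∈ S, f (S.erase i)) / ((N : ℝ) + 1),
        levelAvg_succ_erase (Nat.lt_succ_self N) fun _ T => f T]
      refine levelAvg_congr fun T hT => ?_
      have hc : Tᶜ.card = 1 := by rw [Finset.card_compl, hT, Fintype.card_fin]; omega
      obtain ⟨i, hi⟩ := Finset.card_eq_one.1 hc
      have hins : insert i T = Finset.univ := by
        rw [Finset.insert_eq, ← hi, Finset.union_comm, Finset.union_compl]
      simp [hi, hins, hf]
    rw [e2] at e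
    have h'' := e.symm.trans_le h'
    have hN : (0 : ℝ) < N + 1 := by positivity
    rw [div_le_iff₀ hN] at h''
    push_cast at h''
    rw [Finset.sum_sub_distrib, Finset.sum_const, Finset.card_univ, Fintype.card_fin,
      nsmul_eq_mul]
    push_cast
    set E := ∑ σ, μ σ * φ (g (restrict Finset.univ σ))
    have e3 : C * ((1 - 1 / (C * (N + 1))) * E * (N + 1)) = C * ((N + 1) * E) - E := by
      field_simp
    have := mul_le_mul_of_nonneg_left h'' hC.le
    rw [e3] at this
    linarith
  set b := ∑ σ, μ σ * g (restrict Finset.univ σ) with hb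
  have hb0 : 0 ≤ b := Finset.sum_nonneg fun σ _ => mul_nonneg (hμ.1 σ) (hg _)
  rcases hb0.eq_or_lt with h0 | hpos
  -- With mean zero, g vanishes on the support of `μ`: the left side is 0 and the right side is
  -- nonnegative by Jensen.
  · have hz := (Finset.sum_eq_zero_iff_of_nonneg
      (fun σ _ => mul_nonneg (hμ.1 σ) (hg _))).1 (hb.symm.trans h0.symm)
    have e : ∑ σ, μ σ * φ (g (restrict Finset.univ σ)) = φ 0 := by
      rw [← one_mul (φ 0), ← hμ.2, Finset.sum_mul]
      refine Finset.sum_congr rfl fun σ hσ => ?_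
      rcases mul_eq_zero.1 (hz σ hσ) with h | h
      · rw [h, zero_mul, zero_mul]
      · rw [h]
    rw [← h0, e, sub_self, ← e]
    exact mul_nonneg hC.le (Finset.sum_nonneg fun i _ => sub_nonneg.2
      (sum_map_condMean_le hμ.1 hφ.convexOn _ fun σ => hg _))
  -- Normalizing to mean 1 scales every entropy by the same s. Conditional means keep the mean b, so
  -- the terms `φ b` cancel in the differences.
  · obtain ⟨s, hs, hscale⟩ := hφ.entropy_smul b⁻¹ (inv_pos.2 hpos)
    have hmean : ∑ σ, μ σ * (b⁻¹ * g (restrict Finset.univ σ)) = 1 := by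
      rw [← inv_mul_cancel₀ hpos.ne']
      nth_rw 3 [hb]
      rw [Finset.mul_sum]
      exact Finset.sum_congr rfl fun σ _ => by ring
    have key := normalized (fun A => b⁻¹ * g A) (fun A => mul_nonneg (inv_pos.2 hpos).le (hg A))
      hmean
    have e1 := hscale _ μ (fun σ => g (restrict Finset.univ σ)) hμ.2 hpos
    rw [hmean, hφ.map_one, sub_zero, ← hb] at e1
    have e2 : ∀ i : Fin (N + 1), ∑ σ, μ σ * φ (condMean μ (restrict (Finset.univ.erase i))
          (fun σ => b⁻¹ * g (restrict Finset.univ σ)) σ)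
        = s * (∑ σ, μ σ * φ (condMean μ (restrict (Finset.univ.erase i))
          (fun σ => g (restrict Finset.univ σ)) σ) - φ b) := by
      intro i
      have hm := sum_condMean hμ.1 (restrict (Finset.univ.erase i))
        (fun σ => g (restrict Finset.univ σ))
      have h3 := hscale _ μ (condMean μ (restrict (Finset.univ.erase i))
          (fun σ => g (restrict Finset.univ σ))) hμ.2 (hm.symm ▸ hpos)
      have hcm : ∀ σ, condMean μ (restrict (Finset.univ.erase i))
          (fun σ => b⁻¹ * g (restrict Finset.univ σ)) σ = b⁻¹ * condMean μ
          (restrict (Finset.univ.erase i)) (fun σ => g (restrict Finset.univ σ)) σ := by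
        intro σ
        rw [condMean, condMean, ← mul_div_assoc, Finset.mul_sum]
        congr 1
        exact Finset.sum_congr rfl fun τ _ => by ring
      have hm2 : ∑ σ, μ σ * (b⁻¹ * condMean μ (restrict (Finset.univ.erase i))
          (fun σ => g (restrict Finset.univ σ)) σ) = 1 := by
        simp_rw [← hcm]
        rw [sum_condMean hμ.1, hmean]
      rw [hm2, hφ.map_one, sub_zero, hm] at h3
      simp_rw [hcm]
      exact h3
    rw [e1] at key
    simp_rw [e2, ← mul_sub] at key
    rw [← Finset.mul_sum, mul_left_comm] at key
    have := le_of_mul_le_mul_left key hs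
    simpa only [sub_sub_sub_cancel_right] using this

variable {n : ℕ} {Ω' : Fin n → Type u}

theorem restrict_eq_filter_comp {S T : Finset (Fin n)} (h : T ⊆ S) :
    (restrict T : (∀ i, Ω' i) → _) = (fun A => A.filter fun a => a.1 ∈ T) ∘ restrict S :=
  funext fun σ => (filter_restrict h σ).symm

variable [∀ i, Fintype (Ω' i)] [∀ i, DecidableEq (Ω' i)] {μ : (∀ i, Ω' i) → ℝ}

/-- Approximate tensorization of the `φ`-entropy passes to marginals. -/
theorem Contracts.entropy_restrict_le (hn : 1 ≤ n) (hμ : μ ∈ stdSimplex ℝ (∀ i, Ω' i))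
    {C : ℝ} (hC : 0 < C) (hφ : EntropyFunction.{u} φ γ)
    (h : Contracts φ (down (Σ i, Ω' i) n (n - 1)) (1 - 1 / (C * n)) (homogenization μ))
    {g : Finset (Σ i, Ω' i) → ℝ} (hg : ∀ A, 0 ≤ g A) (S : Finset (Fin n)) :
    ∑ σ, μ σ * φ (g (restrict S σ)) - φ (∑ σ, μ σ * g (restrict S σ))
      ≤ C * ∑ i ∈ S, (∑ σ, μ σ * φ (g (restrict S σ))
        - ∑ σ, μ σ * φ (condMean μ (restrict (S.erase i)) (fun σ => g (restrict S σ)) σ)) := by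
  have key := Contracts.entropy_le hn hμ hC hφ h
    (g := fun A => g (A.filter fun a => a.1 ∈ S)) fun A => hg _
  simp only [filter_restrict (Finset.subset_univ S)] at key
  refine key.trans (mul_le_mul_of_nonneg_left ?_ hC.le)
  rw [← Finset.sum_subset (Finset.subset_univ S)]
  -- For i in S, conditioning on fewer coordinates only increases the loss.
  · refine Finset.sum_le_sum fun i _ => sub_le_sub_left ?_ _
    have hsub : S.erase i ⊆ Finset.univ.erase i := Finset.erase_subset_erase i (Finset.subset_univ S)
    exact sum_map_condMean_mono hμ.1 hφ.convexOn (restrict_eq_filter_comp hsub) fun σ => hg _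
  -- For i outside S, the function depends only on the conditioned coordinates, so nothing is lost.
  · intro i _ hi
    have hsub : S ⊆ Finset.univ.erase i := fun j hj =>
      Finset.mem_erase.2 ⟨fun e => hi (e ▸ hj), Finset.mem_univ j⟩
    rw [sub_eq_zero]
    refine Finset.sum_congr rfl fun σ _ => ?_
    by_cases hσ : μ σ = 0
    · rw [hσ, zero_mul, zero_mul]
    · have := condMean_comp hμ.1 (restrict (Finset.univ.erase i))
        (fun A => g (A.filter fun a => a.1 ∈ S)) hσ
      simp only [Function.comp_def, filter_restrict hsub] at this
      rw [this]

theorem map_mean_le {X : Type*} [Fintype X] (hφ : ConvexOn ℝ (Set.Ici 0) φ) {p v : X → ℝ}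
    (hp : p ∈ stdSimplex ℝ X) (hv : ∀ x, 0 ≤ v x) :
    φ (∑ x, p x * v x) ≤ ∑ x, p x * φ (v x) :=
  hφ.map_sum_le (fun x _ => hp.1 x) hp.2 fun x _ => hv x

theorem levelAvg_map_nonneg (hφ : EntropyFunction.{u} φ γ) {k : ℕ} (hk : k ≤ n)
    {f : Finset (Fin n) → ℝ} (hf : ∀ S, 0 ≤ f S) (h1 : levelAvg k f = 1) :
    0 ≤ levelAvg k fun S => φ (f S) := by
  have h0 : (n.choose k : ℝ) ≠ 0 := by exact_mod_cast (Nat.choose_pos hk).ne'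
  have := hφ.convexOn.map_sum_le (t := Finset.powersetCard k Finset.univ)
    (w := fun _ => (n.choose k : ℝ)⁻¹) (p := f) (fun _ _ => by positivity)
    (by simp [h0]) (fun S _ => hf S)
  simp only [smul_eq_mul, inv_mul_eq_div, ← Finset.sum_div] at this
  rw [← hφ.map_one, ← h1]
  exact this

/-- One level of the local-to-global argument: tensorization controls the entropy given the set of
coordinates, and the Johnson scheme the entropy of the set of coordinates. -/
theorem Contracts.down_succ (hn : 1 ≤ n) (hμ : μ ∈ stdSimplex ℝ (∀ i, Ω' i))
    {C : ℝ} (hC : 0 < C) (hφ : EntropyFunction.{u} φ γ)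
    (h : Contracts φ (down (Σ i, Ω' i) n (n - 1)) (1 - 1 / (C * n)) (homogenization μ))
    {j : ℕ} (hj : j < n) {κ : ℝ} (hκC : κ ≤ 1 / (C * (j + 1)))
    (hκ : ∀ f₀ f₁ : ℝ, 0 ≤ f₁ → γ (n - j) * (j + 1) * f₀ ≤ j * γ (n - (j + 1)) * f₁ →
      f₀ ≤ (1 - κ) * f₁) :
    Contracts φ (down (Σ i, Ω' i) (j + 1) j) (1 - κ) (homLevel μ (j + 1)) := by
  intro ν hν hνμ
  have hlevel := homLevel_mem_stdSimplex hμ (Nat.succ_le_of_lt hj)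
  obtain ⟨g, hg, rfl⟩ : ∃ g : Finset (Σ i, Ω' i) → ℝ, (∀ A, 0 ≤ g A) ∧
      ν = fun A : Slice (Σ i, Ω' i) (j + 1) => homLevel μ (j + 1) A * g A.1 := by
    refine ⟨fun A => if hA : A.card = j + 1 then ν ⟨A, hA⟩ / homLevel μ (j + 1) ⟨A, hA⟩ else 0,
      fun A => ?_, funext fun A => ?_⟩
    · dsimp only
      split_ifs
      · exact div_nonneg (hν.1 _) (hlevel.1 _)
      · rfl
    · simp only [dif_pos A.2]
      by_cases hA : homLevel μ (j + 1) A = 0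
      · rw [hA, zero_mul, hνμ A hA]
      · rw [mul_div_cancel₀ _ hA]
  have hmass := hν.2
  rw [sum_homLevel] at hmass
  rw [fDiv_vecMul_down φ hj, fDiv_homLevel]
  set m : Finset (Fin n) → ℝ := fun S => ∑ σ, μ σ * g (restrict S σ) with hm
  have hm0 : ∀ S, 0 ≤ m S := fun S => Finset.sum_nonneg fun σ _ => mul_nonneg (hμ.1 σ) (hg _)
  set E : Finset (Fin n) → ℝ := fun S => ∑ σ, μ σ * φ (g (restrict S σ)) with hE
  set G : Fin n → Finset (Fin n) → ℝ := fun i T => ∑ σ, μ σ * φ (condMean μ (restrict T)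
    (fun σ => g (restrict (insert i T) σ)) σ) with hG
  have hj1 : (0 : ℝ) < j + 1 := by positivity
  -- tensorization
  have h1 : levelAvg (j + 1) E - levelAvg (j + 1) (fun S => φ (m S)) ≤ C * (j + 1) *
      (levelAvg (j + 1) E - levelAvg j fun T => (∑ i ∈ Tᶜ, G i T) / (Tᶜ.card : ℝ)) := by
    rw [← levelAvg_succ_erase hj, ← levelAvg_sub, ← levelAvg_sub, ← levelAvg_const_mul]
    refine levelAvg_mono fun S hS => (Contracts.entropy_restrict_le hn hμ hC hφ h hg S).trans
      (le_of_eq ?_)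
    have e : ∀ i ∈ S, G i (S.erase i) = ∑ σ, μ σ * φ (condMean μ (restrict (S.erase i))
        (fun σ => g (restrict S σ)) σ) := fun i hi => by simp only [hG, Finset.insert_erase hi]
    rw [Finset.sum_sub_distrib, Finset.sum_const, hS, nsmul_eq_mul, ← Finset.sum_congr rfl e]
    push_cast
    simp only [hE]
    field_simp
  -- convexity of the entropy
  have h2 : (levelAvg j fun T => ∑ σ, μ σ * φ ((∑ i ∈ Tᶜ,
        condMean μ (restrict T) (fun σ => g (restrict (insert i T) σ)) σ) / (Tᶜ.card : ℝ)))
      - levelAvg j (fun T => φ (upAvg m T))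
      ≤ (levelAvg j fun T => (∑ i ∈ Tᶜ, G i T) / (Tᶜ.card : ℝ))
        - levelAvg (j + 1) fun S => φ (m S) := by
    rw [← levelAvg_upAvg hj, ← levelAvg_sub, ← levelAvg_sub]
    refine levelAvg_mono fun T hT => ?_
    have hne : Tᶜ.Nonempty := by
      rw [← Finset.card_pos, Finset.card_compl, hT, Fintype.card_fin]
      omega
    have := hφ.entropy_average_le _ _ μ Tᶜ
      (fun i => condMean μ (restrict T) fun σ => g (restrict (insert i T) σ)) hμ hne
      fun i => condMean_nonneg hμ.1 _ fun σ => hg _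
    simp_rw [sum_condMean hμ.1] at this
    refine this.trans (le_of_eq ?_)
    rw [Finset.sum_sub_distrib, sub_div]
    rfl
  -- the Johnson scheme
  have h3 := hκ _ _ (levelAvg_map_nonneg hφ hj hm0 hmass) (hφ.levelAvg_upAvg_le hj hm0 hmass)
  have h4 : 0 ≤ levelAvg (j + 1) E - levelAvg (j + 1) (fun S => φ (m S)) :=
    sub_nonneg.2 (levelAvg_mono fun S _ => map_mean_le hφ.convexOn hμ fun σ => hg _)
  have h5 := mul_le_mul_of_nonneg_right hκC h4
  have h6 : 1 / (C * (j + 1)) * (levelAvg (j + 1) E - levelAvg (j + 1) (fun S => φ (m S)))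
      ≤ levelAvg (j + 1) E - levelAvg j fun T => (∑ i ∈ Tᶜ, G i T) / (Tᶜ.card : ℝ) := by
    rw [one_div_mul_eq_div, div_le_iff₀ (by positivity)]
    linarith
  -- `h2` and `h6` with `h5` contract the configuration part by 1 - κ, and `h3` the set part; adding
  -- them removes the terms φ(m).
  linarith

/-- Contraction of the single steps implies contraction of their composition. -/
theorem contracts_down_prod (hμ : μ ∈ stdSimplex ℝ (∀ i, Ω' i)) {ρ : ℕ → ℝ}
    (hρ : ∀ j < n, 0 ≤ ρ (j + 1))
    (h : ∀ j < n, Contracts φ (down (Σ i, Ω' i) (j + 1) j) (ρ (j + 1)) (homLevel μ (j + 1)))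
    {k ℓ : ℕ} (hℓ : ℓ ≤ k) (hk : k ≤ n) :
    Contracts φ (down (Σ i, Ω' i) k ℓ) (∏ j ∈ Finset.Icc (ℓ + 1) k, ρ j) (homLevel μ k) := by
  have hdown : ∀ ℓ ≤ k, homLevel μ k ᵥ* down (Σ i, Ω' i) k ℓ = homLevel μ ℓ := by
    intro ℓ hℓ
    induction hℓ using Nat.decreasingInduction with
    | self => rw [down_self, Matrix.vecMul_one]
    | of_succ ℓ hℓ ih =>
      rw [← down_mul_down hℓ, ← Matrix.vecMul_vecMul, ih,
        homLevel_vecMul_down (hℓ.trans_le hk)]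
  induction hℓ using Nat.decreasingInduction with
  | self =>
    intro ν _ _
    simp [down_self]
  | of_succ ℓ hℓ ih =>
    intro ν hν hνμ
    have hlevel := homLevel_mem_stdSimplex hμ hk
    have hstep := h ℓ (hℓ.trans_le hk) (ν ᵥ* down (Σ i, Ω' i) k (ℓ + 1))
      (vecMul_mem_stdSimplex hν (down_nonneg _ _) (sum_down hℓ))
      (by
        rw [← hdown (ℓ + 1) hℓ]
        exact vecMul_eq_zero_of_eq_zero hlevel.1 (down_nonneg _ _) hνμ)
    have hprev := ih ν hν hνμ
    rw [hdown (ℓ + 1) hℓ, Finset.Icc_add_one_left_eq_Ioc] at hprev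
    rw [Matrix.vecMul_vecMul, down_mul_down hℓ, homLevel_vecMul_down (hℓ.trans_le hk)] at hstep
    rw [hdown ℓ hℓ.le, ← Finset.mul_prod_Ioc_eq_prod_Icc (Nat.succ_le_of_lt hℓ), mul_assoc]
    exact hstep.trans (mul_le_mul_of_nonneg_left hprev (hρ ℓ (hℓ.trans_le hk)))

end Tensorization

end DownUp

/-! ### Comparison of the rates -/

theorem theoremt {n : ℕ} (hn : 1 ≤ n) {Ω' : Fin n → Type*} [∀ i, Fintype (Ω' i)]
    [∀ i, DecidableEq (Ω' i)] (μ : (∀ i, Ω' i) → ℝ) (hμ : μ ∈ stdSimplex ℝ (∀ i, Ω' i))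
    (C : ℝ) (hC : 0 < C) :
    (DownUp.Contracts DownUp.chiSqFun (DownUp.down (Σ i, Ω' i) n (n - 1)) (1 - 1 / (C * n))
        (DownUp.homogenization μ) →
      ∀ k ℓ : ℕ, ℓ ≤ k → k ≤ n →
        DownUp.Contracts DownUp.chiSqFun (DownUp.down (Σ i, Ω' i) k ℓ)
          (∏ j ∈ Finset.Icc (ℓ + 1) k,
            (1 - 1 / ((j : ℝ) * (C + ((n : ℝ) - (j : ℝ) + 1) / (n : ℝ)))))
          (DownUp.homLevel μ k)) ∧
    (DownUp.Contracts DownUp.klFun (DownUp.down (Σ i, Ω' i) n (n - 1)) (1 - 1 / (C * n))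
        (DownUp.homogenization μ) →
      ∀ k ℓ : ℕ, ℓ ≤ k → k ≤ n →
        DownUp.Contracts DownUp.klFun (DownUp.down (Σ i, Ω' i) k ℓ)
          (∏ j ∈ Finset.Icc (ℓ + 1) k, (1 - 1 / ((j : ℝ) * (C + 1))))
          (DownUp.homLevel μ k) ∧
        DownUp.Contracts DownUp.klFun (DownUp.downUpWalk ℓ (DownUp.homLevel μ k))
          (∏ j ∈ Finset.Icc (ℓ + 1) k, (1 - 1 / ((j : ℝ) * (C + 1))))
          (DownUp.homLevel μ k)) := by
  refine ⟨fun h k ℓ hℓ hk => ?_, fun h k ℓ hℓ hk => ?_⟩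
  · have hn0 : (0 : ℝ) < n := by exact_mod_cast hn
    refine DownUp.contracts_down_prod hμ
      (ρ := fun j : ℕ => 1 - 1 / ((j : ℝ) * (C + ((n : ℝ) - (j : ℝ) + 1) / (n : ℝ))))
      (fun j hj => ?_) (fun j hj => ?_) hℓ hk
    all_goals
      obtain ⟨r, rfl⟩ : ∃ r, n = j + 1 + r := ⟨n - (j + 1), by omega⟩
      have hden : ((j + 1 + r : ℕ) : ℝ) - ((j + 1 : ℕ) : ℝ) + 1 = r + 1 := by push_cast; ring
      have hj1 : (0 : ℝ) < j + 1 := by positivity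
      have hN : (0 : ℝ) < j + 1 + r := by positivity
      have hr1 : (0 : ℝ) < r + 1 := by positivity
      have hX : 0 < ((j + 1 : ℕ) : ℝ) * (C + (r + 1) / ((j + 1 + r : ℕ) : ℝ)) := by positivity
      have hjr : (0 : ℝ) ≤ j * r := by positivity
      rw [hden]
    · rw [sub_nonneg, div_le_one hX]
      push_cast
      -- With n = j + 1 + r this is (j + 1)(r + 1) ≥ n; it makes each factor nonnegative, as
      -- composing contractions requires.
      have h1 : 1 ≤ ((j : ℝ) + 1) * ((r + 1) / (j + 1 + r)) := by
        rw [← mul_div_assoc, le_div_iff₀ hN]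
        linarith
      have h2 := mul_pos hj1 hC
      linarith
    · refine DownUp.Contracts.down_succ hn hμ hC DownUp.entropyFunction_chiSqFun h hj ?_ ?_
      · refine one_div_le_one_div_of_le (by positivity) ?_
        push_cast
        have : 0 ≤ ((j : ℝ) + 1) * ((r + 1) / (j + 1 + r)) := by positivity
        linarith
      · intro f₀ f₁ hf₁ hf
        have e1 : j + 1 + r - j = r + 1 := by omega
        have e2 : j + 1 + r - (j + 1) = r := by omega
        rw [e1, e2] at hf
        push_cast at hf ⊢
        -- The right side is the Johnson rate n/((n - j)(j + 1)), obtained from the stated one by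
        -- dropping C.
        have h1 : 1 / (((j : ℝ) + 1) * (C + (r + 1) / (j + 1 + r)))
            ≤ (j + 1 + r) / ((r + 1) * (j + 1)) := by
          rw [div_le_div_iff₀ (by positivity) (by positivity)]
          have : (j + 1 + r) * ((j + 1) * (C + (r + 1) / (j + 1 + r)))
            = (j + 1 + r) * (j + 1) * C + ((r : ℝ) + 1) * (j + 1) := by field_simp
          have h2 : 0 ≤ ((j : ℝ) + 1 + r) * (j + 1) * C := by positivity
          linarith
        have h2 := mul_le_mul_of_nonneg_right h1 hf₁
        have h3 : f₀ ≤ (1 - (j + 1 + r) / (((r : ℝ) + 1) * (j + 1))) * f₁ := by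
          have e : (1 - (j + 1 + r) / (((r : ℝ) + 1) * (j + 1))) * f₁
              = (j * r * f₁) / ((r + 1) * (j + 1)) := by field_simp; ring
          rw [e, le_div_iff₀ (by positivity)]
          linarith
        linarith
  · have hstep : DownUp.Contracts DownUp.klFun (DownUp.down (Σ i, Ω' i) k ℓ)
        (∏ j ∈ Finset.Icc (ℓ + 1) k, (1 - 1 / ((j : ℝ) * (C + 1)))) (DownUp.homLevel μ k) := by
      refine DownUp.contracts_down_prod hμ
        (ρ := fun j : ℕ => 1 - 1 / ((j : ℝ) * (C + 1))) (fun j hj => ?_) (fun j hj => ?_) hℓ hk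
      all_goals
        have hj0 : (0 : ℝ) ≤ j := Nat.cast_nonneg j
        have hj1 : (0 : ℝ) < j + 1 := by positivity
        have hjC : 0 ≤ (j : ℝ) * C := by positivity
        push_cast
      · rw [sub_nonneg, div_le_one (by positivity)]
        linarith
      · refine DownUp.Contracts.down_succ hn hμ hC DownUp.entropyFunction_klFun h hj ?_ ?_
        · refine one_div_le_one_div_of_le (by positivity) ?_
          linarith
        · intro f₀ f₁ hf₁ hf
          -- For KL the Johnson rate is 1/(j + 1).
          have h1 : 1 / (((j : ℝ) + 1) * (C + 1)) ≤ 1 / (j + 1) :=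
            one_div_le_one_div_of_le hj1 (by linarith)
          have h2 := mul_le_mul_of_nonneg_right h1 hf₁
          have h3 : f₀ ≤ (1 - 1 / ((j : ℝ) + 1)) * f₁ := by
            have e : (1 - 1 / ((j : ℝ) + 1)) * f₁ = (j * f₁) / (j + 1) := by field_simp; ring
            rw [e, le_div_iff₀ hj1]
            linarith
          linarith
    exact ⟨hstep, hstep.downUpWalk DownUp.convexOn_klFun
      (DownUp.homLevel_mem_stdSimplex hμ hk).1⟩
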